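/- A graph $G$ on a finite vertex set $V$ is given by a symmetric matrix $A=(w_{uv})_{u,v\in V}$ of non-negative edge weights (self-loops $w_{vv}>0$ are allowed) with $\sum_{v}w_{uv}=1$ for every $u\in V$. For non-empty $S\subseteq V$ let $\phi(S)=\frac1{|S|}\sum_{u\in S,\,v\notin S}w_{uv}$, and let $\phi(G)=\min\{\phi(S): \emptyset\ne S\subseteq V,\ |S|\le |V|/2\}$. Let $\lambda_1(G)\le\lambda_2(G)\le\dots\le\lambda_{|V|}(G)$ be the eigenvalues, with multiplicity, of $L=I-A$. (1) Let $k\ge 2$ be an integer and let $C\ge 1/10$ be a real number such that $\phi(H)\le C\,\lambda_2(H)$ for every graph $H$ with at least $k$ vertices and $\lambda_k(H)\ge 1/4$. Then for every graph $G$ with at least $k$ vertices $$\phi(G)\le \frac{40\,C\,\lambda_2(G)}{\sqrt{\lambda_k(G)}} .$$ (2) (Improved Cheeger inequality.) There is an absolute constant $K>0$ such that for every integer $k\ge2$ and every graph $G$ with at least $k$ vertices $$\phi(G)\le \frac{K\,k\,\lambda_2(G)}{\sqrt{\lambda_k(G)}} .$$ (If $\lambda_k(G)=0$, then also $\lambda_2(G)=0$,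 and the right-hand sides are read as $0$, so that the claims then say $\phi(G)=0$.) -/

import Mathlib

universe u

/-- A finite weighted undirected graph on the vertex set `V`, given by its adjacency matrix:
`weight u v` is the weight of the edge `uv` (zero if there is no edge), and the total weight at
every vertex is one. Self-loops (`weight v v > 0`) are allowed, as is needed for the lazy random
walk matrix of a graph and its powers to be adjacency matrices of graphs. -/
structure RegularWeightedGraph (V : Type u) [Fintype V] where
  /-- the adjacency matrix -/
  weight : Matrix V V ℝ
  nonneg : ∀ u v, 0 ≤ weight u v
  symm : ∀ u v, weight u v = weight v u
  total_weight : ∀ u, ∑ v, weight u v = 1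

namespace RegularWeightedGraph

variable {V : Type u} [Fintype V] [DecidableEq V]

/-- `w(S, T)`: the total weight of the edges between the (disjoint) sets `S` and `T`. -/
def weightBetween (G : RegularWeightedGraph V) (S T : Finset V) : ℝ :=
  ∑ u ∈ S, ∑ v ∈ T, G.weight u v

/-- The edge expansion `φ(S) = w(S, Sᶜ) / |S|` of a nonempty set of vertices. -/
noncomputable def setExpansion (G : RegularWeightedGraph V) (S : Finset V) : ℝ :=
  G.weightBetween S Sᶜ / (S.card : ℝ)

/-- The edge expansion `φ(G)`: the minimum of `φ(S)` over the nonempty `S` with `|S| ≤ |V| / 2`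
(such sets exist as soon as `|V| ≥ 2`, and the infimum is then attained). -/
noncomputable def edgeExpansion (G : RegularWeightedGraph V) : ℝ :=
  sInf {r : ℝ | ∃ S : Finset V, S.Nonempty ∧ 2 * S.card ≤ Fintype.card V ∧ r = G.setExpansion S}

/-- The Laplacian matrix `L = I - A`. -/
def laplacian (G : RegularWeightedGraph V) : Matrix V V ℝ := 1 - G.weight

theorem laplacian_isHermitian (G : RegularWeightedGraph V) : G.laplacian.IsHermitian := by
  ext i j
  simp [laplacian, Matrix.one_apply, G.symm i j, eq_comm]

/-- `λ_k(G)` for `1 ≤ k ≤ |V|`: the `k`-th smallest eigenvalue of the Laplacian, counted with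
multiplicity. (Mathlib's `eigenvalues₀` lists the eigenvalues in decreasing order, starting at
index `0`.) Outside this range of `k` the value is `0`. -/
noncomputable def lambda (G : RegularWeightedGraph V) (k : ℕ) : ℝ :=
  if h : 1 ≤ k ∧ k ≤ Fintype.card V then
    G.laplacian_isHermitian.eigenvalues₀ ⟨Fintype.card V - k, by omega⟩
  else 0

/-- For `|V| ≥ 2` the infimum defining `edgeExpansion` is a minimum. -/
theorem isLeast_edgeExpansion (G : RegularWeightedGraph V) (hV : 2 ≤ Fintype.card V) :
    IsLeast {r : ℝ | ∃ S : Finset V,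
      S.Nonempty ∧ 2 * S.card ≤ Fintype.card V ∧ r = G.setExpansion S} G.edgeExpansion := by
  have hfin : {r : ℝ | ∃ S : Finset V,
      S.Nonempty ∧ 2 * S.card ≤ Fintype.card V ∧ r = G.setExpansion S}.Finite := by
    refine (Set.finite_range G.setExpansion).subset ?_
    rintro r ⟨S, -, -, rfl⟩
    exact ⟨S, rfl⟩
  have hne : {r : ℝ | ∃ S : Finset V,
      S.Nonempty ∧ 2 * S.card ≤ Fintype.card V ∧ r = G.setExpansion S}.Nonempty := by
    obtain ⟨v⟩ : Nonempty V := Fintype.card_pos_iff.mp (by omega)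
    exact ⟨_, {v}, Finset.singleton_nonempty v, by simpa using hV, rfl⟩
  exact ⟨hne.csInf_mem hfin, fun r hr => csInf_le hfin.bddBelow hr⟩

end RegularWeightedGraph

/-! Both parts round a function into a set through the coarea inequality
`edgeExpansion_mul_sum_le_variation`: φ(G)·∑h is at most the total variation of h, for h ≥ 0
supported on at most half of the vertices. Applied to f² it gives Cheeger's inequality; the gain
comes from replacing the square by a function that is flat where the values concentrate.

Part (2), with K = 96, is proved directly, independently of part (1). Let f ≥ 0 have energy E ≤
λ₂‖f‖². Cut the range of f greedily by thresholds so that the tents between consecutive ones have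
equal squared norm. Were there 2k full tents, at least k would have energy at most E/k and, being
disjointly supported, would force λ_k too low (`lambda_le_of_disjoint`). Hence f is within squared
distance 8E/λ_k of a set T of at most 2k + 1 values (`exists_step_approximation`). Use h = ∫₀^f
dist(x, T) dx: it is at least f²/(8|T|), while Cauchy–Schwarz bounds its variation by O(E/√λ_k).

Part (1) applies the hypothesis to the graph H of P^t, where P = (I + A)/2 and t = 2s + 1 is of
order 1/λ_k. Then λ_k(H) ≥ 1/4 and λ₂(H) ≤ tλ₂/2, so it suffices that φ(H), when small, is at least
of order √t·φ(G) (`edgeExpansion_mul_le_lazyPower`). If S has boundary D in H, then g = P^s 1_S is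
within squared distance D of 1_S and has energy at most 2D/t. The cubic 3g² − 2g³, flat at 0 and 1,
therefore has variation O(D/√t) and is 3D-close to 1_S in ℓ¹; coarea about a median concludes. If
φ(H) is not small, λ₂ is so large that Cheeger's inequality is enough. -/

namespace RegularWeightedGraph

variable {V : Type u} [Fintype V] [DecidableEq V]

open Matrix

/-! ### Dirichlet energy, spectral decomposition and min-max bounds for λ_k. -/

/-- The Dirichlet energy of a function on the vertices. -/
noncomputable def energy (G : RegularWeightedGraph V) (f : V → ℝ) : ℝ :=
  (∑ u, ∑ v, G.weight u v * (f u - f v) ^ 2) / 2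

omit [DecidableEq V] in
theorem sum_sum_weight_mul_left (G : RegularWeightedGraph V) (f : V → ℝ) :
    ∑ u, ∑ v, G.weight u v * f u = ∑ u, f u := by
  refine Finset.sum_congr rfl fun u _ => ?_
  rw [← Finset.sum_mul, G.total_weight, one_mul]

omit [DecidableEq V] in
theorem sum_sum_weight_mul_right (G : RegularWeightedGraph V) (f : V → ℝ) :
    ∑ u, ∑ v, G.weight u v * f v = ∑ u, f u := by
  rw [Finset.sum_comm, ← G.sum_sum_weight_mul_left f]
  exact Finset.sum_congr rfl fun u _ => Finset.sum_congr rfl fun v _ => by rw [G.symm]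

omit [DecidableEq V] in
theorem energy_nonneg (G : RegularWeightedGraph V) (f : V → ℝ) : 0 ≤ G.energy f := by
  unfold energy
  have : 0 ≤ ∑ u, ∑ v, G.weight u v * (f u - f v) ^ 2 :=
    Finset.sum_nonneg fun u _ => Finset.sum_nonneg fun v _ =>
      mul_nonneg (G.nonneg u v) (sq_nonneg _)
  linarith

omit [DecidableEq V] in
theorem energy_eq_sub (G : RegularWeightedGraph V) (f : V → ℝ) :
    G.energy f = f ⬝ᵥ f - f ⬝ᵥ (G.weight *ᵥ f) := by
  have h1 := G.sum_sum_weight_mul_left (fun u => f u ^ 2)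
  have h2 := G.sum_sum_weight_mul_right (fun u => f u ^ 2)
  have h3 : f ⬝ᵥ (G.weight *ᵥ f) = ∑ u, ∑ v, G.weight u v * (f u * f v) := by
    simp only [dotProduct, mulVec, Finset.mul_sum]
    exact Finset.sum_congr rfl fun u _ => Finset.sum_congr rfl fun v _ => by ring
  have h4 : f ⬝ᵥ f = ∑ u, f u ^ 2 := by
    simp only [dotProduct, sq]
  have h5 : ∑ u, ∑ v, G.weight u v * (f u - f v) ^ 2 =
      (∑ u, ∑ v, G.weight u v * f u ^ 2) + (∑ u, ∑ v, G.weight u v * f v ^ 2) -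
        2 * ∑ u, ∑ v, G.weight u v * (f u * f v) := by
    simp only [Finset.mul_sum, ← Finset.sum_add_distrib, ← Finset.sum_sub_distrib]
    exact Finset.sum_congr rfl fun u _ => Finset.sum_congr rfl fun v _ => by ring
  rw [energy, h5, h1, h2, h3, h4]
  ring

theorem dotProduct_laplacian (G : RegularWeightedGraph V) (f : V → ℝ) :
    f ⬝ᵥ (G.laplacian *ᵥ f) = G.energy f := by
  rw [G.energy_eq_sub, laplacian, sub_mulVec, one_mulVec, dotProduct_sub]

omit [DecidableEq V] in
theorem energy_le (G : RegularWeightedGraph V) (f : V → ℝ) : G.energy f ≤ 2 * (f ⬝ᵥ f) := by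
  have h1 := G.sum_sum_weight_mul_left (fun u => f u ^ 2)
  have h2 := G.sum_sum_weight_mul_right (fun u => f u ^ 2)
  have h4 : f ⬝ᵥ f = ∑ u, f u ^ 2 := by
    simp only [dotProduct, sq]
  have h5 : ∑ u, ∑ v, G.weight u v * (f u - f v) ^ 2 ≤
      2 * (∑ u, ∑ v, G.weight u v * f u ^ 2) + 2 * (∑ u, ∑ v, G.weight u v * f v ^ 2) := by
    simp only [Finset.mul_sum, ← Finset.sum_add_distrib]
    refine Finset.sum_le_sum fun u _ => Finset.sum_le_sum fun v _ => ?_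
    nlinarith [mul_nonneg (G.nonneg u v) (sq_nonneg (f u + f v))]
  rw [energy, h4]
  linarith

/-- An orthonormal basis of eigenvectors of the Laplacian, in the order of `eigenvalues₀`. -/
theorem exists_eigenbasis (G : RegularWeightedGraph V) :
    ∃ b : Fin (Fintype.card V) → V → ℝ,
      (∀ i j, b i ⬝ᵥ b j = if i = j then 1 else 0) ∧
      (∀ i, G.laplacian *ᵥ b i = G.laplacian_isHermitian.eigenvalues₀ i • b i) ∧
      ∀ f : V → ℝ, f = ∑ i, (b i ⬝ᵥ f) • b i := by
  let e : Fin (Fintype.card V) ≃ V := Fintype.equivOfCardEq (Fintype.card_fin _)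
  let B := G.laplacian_isHermitian.eigenvectorBasis.reindex e.symm
  have hin : ∀ x y : EuclideanSpace ℝ V, inner ℝ x y = WithLp.ofLp x ⬝ᵥ WithLp.ofLp y := by
    intro x y
    rw [EuclideanSpace.inner_eq_star_dotProduct, dotProduct_comm]
    simp
  refine ⟨fun i => WithLp.ofLp (B i), fun i j => ?_, fun i => ?_, fun f => ?_⟩
  · rw [← hin]
    exact orthonormal_iff_ite.mp B.orthonormal i j
  · have := G.laplacian_isHermitian.mulVec_eigenvectorBasis (e i)
    simpa [B, Matrix.IsHermitian.eigenvalues, e] using this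
  · have := congrArg WithLp.ofLp (B.sum_repr' (WithLp.toLp 2 f))
    simp only [hin] at this
    simpa using this.symm

omit [DecidableEq V] in
-- Dimension count: fewer linear conditions than coefficients. It supplies the test vectors for the
-- min-max arguments.
theorem exists_ne_zero_orthogonal {ι κ : Type*} [Fintype ι] [Fintype κ]
    (h : Fintype.card κ < Fintype.card ι) (F : ι → V → ℝ) (B : κ → V → ℝ) :
    ∃ c : ι → ℝ, c ≠ 0 ∧ ∀ j, B j ⬝ᵥ (∑ i, c i • F i) = 0 := by
  let T : (ι → ℝ) →ₗ[ℝ] (κ → ℝ) :=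
    { toFun := fun c j => B j ⬝ᵥ (∑ i, c i • F i)
      map_add' := fun c d => by
        ext j; simp [add_smul, Finset.sum_add_distrib, dotProduct_add]
      map_smul' := fun a c => by
        ext j
        simp [mul_smul, ← Finset.smul_sum, dotProduct_smul] }
  have hk : LinearMap.ker T ≠ ⊥ := LinearMap.ker_ne_bot_of_finrank_lt (by simpa using h)
  obtain ⟨c, hc, hc0⟩ := (Submodule.ne_bot_iff _).mp hk
  exact ⟨c, hc0, fun j => congrFun (LinearMap.mem_ker.mp hc) j⟩

omit [DecidableEq V] in
theorem dotProduct_self_eq_sum {n : ℕ} {b : Fin n → V → ℝ}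
    (hb : ∀ f : V → ℝ, f = ∑ i, (b i ⬝ᵥ f) • b i) (f g : V → ℝ) :
    f ⬝ᵥ g = ∑ i, (b i ⬝ᵥ f) * (b i ⬝ᵥ g) := by
  conv_lhs => rw [hb f]
  simp [sum_dotProduct]

theorem lambda_eq (G : RegularWeightedGraph V) {k : ℕ} (h1 : 1 ≤ k) (hk : k ≤ Fintype.card V) :
    G.lambda k = G.laplacian_isHermitian.eigenvalues₀ ⟨Fintype.card V - k, by omega⟩ := by
  rw [lambda, dif_pos ⟨h1, hk⟩]

theorem laplacian_mulVec_dotProduct (G : RegularWeightedGraph V) (f g : V → ℝ) :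
    f ⬝ᵥ (G.laplacian *ᵥ g) = (G.laplacian *ᵥ f) ⬝ᵥ g := by
  rw [dotProduct_mulVec, ← mulVec_transpose]
  congr 2
  have := G.laplacian_isHermitian
  rwa [IsHermitian, conjTranspose_eq_transpose_of_trivial] at this

theorem energy_eq_sum (G : RegularWeightedGraph V) {b : Fin (Fintype.card V) → V → ℝ}
    (hL : ∀ i, G.laplacian *ᵥ b i = G.laplacian_isHermitian.eigenvalues₀ i • b i)
    (hb : ∀ f : V → ℝ, f = ∑ i, (b i ⬝ᵥ f) • b i) (f : V → ℝ) :
    G.energy f = ∑ i, G.laplacian_isHermitian.eigenvalues₀ i * (b i ⬝ᵥ f) ^ 2 := by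
  rw [← G.dotProduct_laplacian, dotProduct_self_eq_sum hb]
  refine Finset.sum_congr rfl fun i _ => ?_
  rw [laplacian_mulVec_dotProduct, hL, smul_dotProduct, smul_eq_mul]
  ring

/-- Courant–Fischer: a space of dimension at least k contains a nonzero vector orthogonal to the
eigenvectors of the k − 1 smallest eigenvalues, which are the indices above |V| − k in the
decreasing order. Its Rayleigh quotient is at least λ_k. -/
theorem lambda_le_of_linearIndependent (G : RegularWeightedGraph V) {k : ℕ} (h1 : 1 ≤ k)
    (hk : k ≤ Fintype.card V) {ι : Type*} [Fintype ι] (hι : k ≤ Fintype.card ι)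
    {F : ι → V → ℝ} (hF : LinearIndependent ℝ F) {r : ℝ}
    (hr : ∀ c : ι → ℝ, G.energy (∑ i, c i • F i) ≤
      r * ((∑ i, c i • F i) ⬝ᵥ (∑ i, c i • F i))) :
    G.lambda k ≤ r := by
  obtain ⟨b, -, hL, hb⟩ := G.exists_eigenbasis
  have hcard : Fintype.card (Finset.Ioi (⟨Fintype.card V - k, by omega⟩ : Fin (Fintype.card V)))
      < Fintype.card ι := by
    rw [Fintype.card_coe, Fin.card_Ioi]
    simp only
    omega
  obtain ⟨c, hc0, hc⟩ := exists_ne_zero_orthogonal hcard F (fun j => b j.1)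
  set f := ∑ i, c i • F i with hf
  have hf0 : f ≠ 0 := fun h => hc0 (funext (Fintype.linearIndependent_iff.mp hF c h))
  have hpos : 0 < f ⬝ᵥ f := by
    have := dotProduct_star_self_pos_iff (v := f)
    simpa using this.mpr hf0
  have h2 : G.lambda k * (f ⬝ᵥ f) ≤ G.energy f := by
    rw [G.energy_eq_sum hL hb, dotProduct_self_eq_sum hb, Finset.mul_sum, G.lambda_eq h1 hk]
    refine Finset.sum_le_sum fun i _ => ?_
    by_cases hi : i ∈ Finset.Ioi (⟨Fintype.card V - k, by omega⟩ : Fin (Fintype.card V))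
    · rw [hc ⟨i, hi⟩]; simp
    · rw [Finset.mem_Ioi, not_lt] at hi
      have := G.laplacian_isHermitian.eigenvalues₀_antitone hi
      nlinarith [sq_nonneg (b i ⬝ᵥ f)]
  exact le_of_mul_le_mul_right (h2.trans (hr c)) hpos

/-- The dual min-max bound: only |V| − k eigenvectors precede that of λ_k, so a space of larger
dimension has a nonzero vector orthogonal to all of them. -/
theorem le_lambda_of_linearIndependent (G : RegularWeightedGraph V) {k : ℕ} (h1 : 1 ≤ k)
    (hk : k ≤ Fintype.card V) {ι : Type*} [Fintype ι]
    (hι : Fintype.card V < Fintype.card ι + k)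
    {F : ι → V → ℝ} (hF : LinearIndependent ℝ F) {r : ℝ}
    (hr : ∀ c : ι → ℝ, r * ((∑ i, c i • F i) ⬝ᵥ (∑ i, c i • F i)) ≤
      G.energy (∑ i, c i • F i)) :
    r ≤ G.lambda k := by
  obtain ⟨b, -, hL, hb⟩ := G.exists_eigenbasis
  have hcard : Fintype.card (Finset.Iio (⟨Fintype.card V - k, by omega⟩ : Fin (Fintype.card V)))
      < Fintype.card ι := by
    rw [Fintype.card_coe, Fin.card_Iio]
    simp only
    omega
  obtain ⟨c, hc0, hc⟩ := exists_ne_zero_orthogonal hcard F (fun j => b j.1)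
  set f := ∑ i, c i • F i with hf
  have hf0 : f ≠ 0 := fun h => hc0 (funext (Fintype.linearIndependent_iff.mp hF c h))
  have hpos : 0 < f ⬝ᵥ f := by
    have := dotProduct_star_self_pos_iff (v := f)
    simpa using this.mpr hf0
  have h2 : G.energy f ≤ G.lambda k * (f ⬝ᵥ f) := by
    rw [G.energy_eq_sum hL hb, dotProduct_self_eq_sum hb, Finset.mul_sum, G.lambda_eq h1 hk]
    refine Finset.sum_le_sum fun i _ => ?_
    by_cases hi : i ∈ Finset.Iio (⟨Fintype.card V - k, by omega⟩ : Fin (Fintype.card V))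
    · rw [hc ⟨i, hi⟩]; simp
    · rw [Finset.mem_Iio, not_lt] at hi
      have := G.laplacian_isHermitian.eigenvalues₀_antitone hi
      nlinarith [sq_nonneg (b i ⬝ᵥ f)]
  exact le_of_mul_le_mul_right ((hr c).trans h2) hpos

omit [DecidableEq V] in
theorem linearIndependent_of_orthonormal {ι : Type*} [Fintype ι] [DecidableEq ι]
    {b : ι → V → ℝ} (ho : ∀ i j, b i ⬝ᵥ b j = if i = j then 1 else 0) :
    LinearIndependent ℝ b := by
  rw [Fintype.linearIndependent_iff]
  intro c hc i
  have := congrArg (fun f => b i ⬝ᵥ f) hc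
  simpa [dotProduct_sum, ho] using this

theorem eigenvalues₀_mem_Icc (G : RegularWeightedGraph V) (i : Fin (Fintype.card V)) :
    G.laplacian_isHermitian.eigenvalues₀ i ∈ Set.Icc (0 : ℝ) 2 := by
  obtain ⟨b, ho, hL, -⟩ := G.exists_eigenbasis
  have h : G.energy (b i) = G.laplacian_isHermitian.eigenvalues₀ i := by
    rw [← G.dotProduct_laplacian, hL, dotProduct_smul, ho]; simp
  have h1 := G.energy_nonneg (b i)
  have h2 := G.energy_le (b i)
  rw [ho] at h2
  simp only [if_true, mul_one] at h2
  exact ⟨h ▸ h1, h ▸ h2⟩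

theorem lambda_mem_Icc (G : RegularWeightedGraph V) (k : ℕ) : G.lambda k ∈ Set.Icc (0 : ℝ) 2 := by
  unfold lambda
  split_ifs
  · exact G.eigenvalues₀_mem_Icc _
  · norm_num

theorem lambda_mono (G : RegularWeightedGraph V) {j k : ℕ} (hj : 1 ≤ j) (hjk : j ≤ k)
    (hk : k ≤ Fintype.card V) : G.lambda j ≤ G.lambda k := by
  rw [G.lambda_eq hj (hjk.trans hk), G.lambda_eq (hj.trans hjk) hk]
  exact G.laplacian_isHermitian.eigenvalues₀_antitone (Fin.mk_le_mk.mpr (by omega))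

/-- A nonzero function of mean zero whose Rayleigh quotient is at most `λ₂`. -/
theorem exists_sum_eq_zero_energy_le (G : RegularWeightedGraph V) (hV : 2 ≤ Fintype.card V) :
    ∃ f : V → ℝ, f ≠ 0 ∧ ∑ v, f v = 0 ∧ G.energy f ≤ G.lambda 2 * (f ⬝ᵥ f) := by
  obtain ⟨b, ho, hL, hb⟩ := G.exists_eigenbasis
  -- The two smallest eigenvalues. Some nonzero combination of their eigenvectors has mean zero,
  -- whether or not either of them is constant.
  let I := Finset.Ici (⟨Fintype.card V - 2, by omega⟩ : Fin (Fintype.card V))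
  have hcard : Fintype.card Unit < Fintype.card I := by
    rw [Fintype.card_coe, Fin.card_Ici]
    simp only [Fintype.card_unit]
    omega
  obtain ⟨c, hc0, hc⟩ := exists_ne_zero_orthogonal hcard (fun i : I => b i.1) (fun _ => 1)
  have hli : LinearIndependent ℝ (fun i : I => b i.1) :=
    (linearIndependent_of_orthonormal ho).comp _ Subtype.val_injective
  set f := ∑ i, c i • b i.1 with hf
  refine ⟨f, fun h => hc0 (funext (Fintype.linearIndependent_iff.mp hli c h)), ?_, ?_⟩
  · have := hc ()
    rwa [one_dotProduct] at this
  · rw [G.energy_eq_sum hL hb, dotProduct_self_eq_sum hb, Finset.mul_sum,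
      G.lambda_eq one_le_two hV]
    refine Finset.sum_le_sum fun i _ => ?_
    by_cases hi : i ∈ I
    · have := G.laplacian_isHermitian.eigenvalues₀_antitone (Finset.mem_Ici.mp hi)
      nlinarith [sq_nonneg (b i ⬝ᵥ f)]
    · have : b i ⬝ᵥ f = 0 := by
        rw [hf, dotProduct_sum]
        refine Finset.sum_eq_zero fun j _ => ?_
        rw [dotProduct_smul, ho, if_neg, smul_zero]
        rintro rfl
        exact hi j.2
      rw [this]; simp


/-! ### Total variation, the coarea inequality and Cheeger's inequality. -/

/-- The total variation of a function on the vertices. -/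
noncomputable def variation (G : RegularWeightedGraph V) (h : V → ℝ) : ℝ :=
  (∑ u, ∑ v, G.weight u v * |h u - h v|) / 2

theorem weightBetween_compl (G : RegularWeightedGraph V) (S : Finset V) :
    G.weightBetween S Sᶜ =
      ∑ u, ∑ v, G.weight u v * (if u ∈ S ∧ v ∉ S then 1 else 0) := by
  unfold weightBetween
  rw [← Finset.sum_filter_add_sum_filter_not Finset.univ (· ∈ S)
    (fun u => ∑ v, G.weight u v * (if u ∈ S ∧ v ∉ S then 1 else 0))]
  rw [Finset.sum_eq_zero (s := Finset.univ.filter (· ∉ S)), add_zero]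
  · rw [Finset.filter_mem_eq_inter, Finset.univ_inter]
    refine Finset.sum_congr rfl fun u hu => ?_
    rw [← Finset.sum_filter_add_sum_filter_not Finset.univ (· ∈ Sᶜ)
      (fun v => G.weight u v * (if u ∈ S ∧ v ∉ S then 1 else 0))]
    rw [Finset.sum_eq_zero (s := Finset.univ.filter (· ∉ Sᶜ)), add_zero]
    · rw [Finset.filter_mem_eq_inter, Finset.univ_inter]
      refine Finset.sum_congr rfl fun v hv => ?_
      rw [Finset.mem_compl] at hv
      simp [hu, hv]
    · intro v hv
      simp only [Finset.mem_filter, Finset.mem_compl, not_not] at hv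
      simp [hv.2]
  · intro u hu
    simp only [Finset.mem_filter] at hu
    simp [hu.2]

theorem two_mul_weightBetween_compl (G : RegularWeightedGraph V) (S : Finset V) :
    2 * G.weightBetween S Sᶜ =
      ∑ u, ∑ v, G.weight u v * (if (u ∈ S ↔ v ∈ S) then 0 else 1) := by
  have h1 := G.weightBetween_compl S
  have h2 : G.weightBetween S Sᶜ =
      ∑ u, ∑ v, G.weight u v * (if v ∈ S ∧ u ∉ S then 1 else 0) := by
    rw [h1, Finset.sum_comm]
    exact Finset.sum_congr rfl fun u _ => Finset.sum_congr rfl fun v _ => by rw [G.symm]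
  rw [two_mul]
  nth_rewrite 1 [h1]
  rw [h2]
  simp only [← Finset.sum_add_distrib, ← mul_add]
  refine Finset.sum_congr rfl fun u _ => Finset.sum_congr rfl fun v _ => ?_
  by_cases hu : u ∈ S <;> by_cases hv : v ∈ S <;> simp [hu, hv]

theorem edgeExpansion_mul_card_le (G : RegularWeightedGraph V) (S : Finset V)
    (hS : 2 * S.card ≤ Fintype.card V) :
    G.edgeExpansion * S.card ≤ G.weightBetween S Sᶜ := by
  rcases S.eq_empty_or_nonempty with rfl | hne
  · simp [weightBetween]
  · have hpos : 0 < S.card := hne.card_pos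
    have := (G.isLeast_edgeExpansion (by omega)).2 ⟨S, hne, hS, rfl⟩
    rwa [setExpansion, le_div_iff₀ (by exact_mod_cast hpos)] at this

theorem edgeExpansion_nonneg (G : RegularWeightedGraph V) : 0 ≤ G.edgeExpansion := by
  refine Real.sInf_nonneg ?_
  rintro r ⟨S, -, -, rfl⟩
  exact div_nonneg (Finset.sum_nonneg fun u _ => Finset.sum_nonneg fun v _ => G.nonneg u v)
    (Nat.cast_nonneg _)

/-- The discrete coarea inequality. -/
theorem edgeExpansion_mul_sum_le_variation (G : RegularWeightedGraph V) (h : V → ℝ)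
    (h0 : ∀ v, 0 ≤ h v) (hs : 2 * (Finset.univ.filter fun v => h v ≠ 0).card ≤ Fintype.card V) :
    G.edgeExpansion * ∑ v, h v ≤ G.variation h := by
  induction hn : (Finset.univ.filter fun v => h v ≠ 0).card using Nat.strong_induction_on
    generalizing h with
  | _ n ih =>
  set S := Finset.univ.filter fun v => h v ≠ 0 with hS
  have hmem : ∀ v, v ∈ S ↔ h v ≠ 0 := fun v => by simp [hS]
  rcases S.eq_empty_or_nonempty with he | hne
  · have : h = 0 := by
      ext v
      by_contra hv
      have := (hmem v).mpr hv
      simp [he] at this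
    subst this
    simp [variation]
  · obtain ⟨x, hxS, hx⟩ := S.exists_min_image h hne
    have hx0 : 0 < h x := lt_of_le_of_ne (h0 x) ((hmem x).mp hxS).symm
    -- Peel off the lowest layer: subtracting the least nonzero value on the support S shrinks the
    -- support, and both sides change by that value times the contribution of the cut S.
    let g : V → ℝ := fun v => if v ∈ S then h v - h x else 0
    have hg0 : ∀ v, 0 ≤ g v := by
      intro v
      by_cases hv : v ∈ S
      · simpa [g, hv] using hx v hv
      · simp [g, hv]
    have hsub : (Finset.univ.filter fun v => g v ≠ 0) ⊂ S := by
      refine Finset.ssubset_iff_subset_ne.mpr ⟨fun v hv => ?_, fun hE => ?_⟩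
      · by_contra hvS
        simp [g, hvS] at hv
      · rw [← hE] at hxS
        simp [g] at hxS
    have hcard := Finset.card_lt_card hsub
    have key := ih _ (hn ▸ hcard) g hg0 (by omega) rfl
    have hcut := G.edgeExpansion_mul_card_le S hs
    have hsum : ∑ v, h v = ∑ v, g v + h x * S.card := by
      have : ∀ v, h v = g v + if v ∈ S then h x else 0 := by
        intro v
        by_cases hv : v ∈ S
        · simp [g, hv]
        · have : h v = 0 := by
            by_contra h'
            exact hv ((hmem v).mpr h')
          simp [g, hv, this]
      rw [Finset.sum_congr rfl fun v _ => this v, Finset.sum_add_distrib]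
      simp [mul_comm]
    have hvar : G.variation h = G.variation g + h x * G.weightBetween S Sᶜ := by
      have h2 := G.two_mul_weightBetween_compl S
      have : ∑ u, ∑ v, G.weight u v * |h u - h v| = (∑ u, ∑ v, G.weight u v * |g u - g v|) +
          h x * ∑ u, ∑ v, G.weight u v * (if (u ∈ S ↔ v ∈ S) then 0 else 1) := by
        simp only [Finset.mul_sum, ← Finset.sum_add_distrib]
        refine Finset.sum_congr rfl fun u _ => Finset.sum_congr rfl fun v _ => ?_
        have hz : ∀ w, w ∉ S → h w = 0 := fun w hw => by
          by_contra h'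
          exact hw ((hmem w).mpr h')
        by_cases hu : u ∈ S <;> by_cases hv : v ∈ S
        · simp [g, hu, hv]
        · have := hx u hu
          simp only [g, hu, hv, hz v hv, if_true, if_false, sub_zero, iff_false, not_true]
          rw [abs_of_nonneg (h0 u), abs_of_nonneg (by linarith)]
          ring
        · have := hx v hv
          simp only [g, hu, hv, hz u hu, if_true, if_false, zero_sub, abs_neg, iff_true]
          rw [abs_of_nonneg (h0 v), abs_of_nonneg (by linarith)]
          ring
        · simp [g, hu, hv, hz u hu, hz v hv]
      rw [variation, variation, this, ← h2]
      ring
    rw [hsum, hvar]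
    nlinarith

omit [DecidableEq V] in
-- Take c to be the least value of f with at most half of the vertices strictly above it. The next
-- lower value fails this, so more than half of the vertices have value at least c.
theorem exists_median [Nonempty V] (f : V → ℝ) :
    ∃ c, 2 * (Finset.univ.filter fun v => c < f v).card ≤ Fintype.card V ∧
      2 * (Finset.univ.filter fun v => f v < c).card ≤ Fintype.card V := by
  classical
  let T := Finset.univ.filter fun x => 2 * (Finset.univ.filter fun v => f x < f v).card ≤
    Fintype.card V
  have hT : T.Nonempty := by
    obtain ⟨x, -, hx⟩ := Finset.univ.exists_max_image f Finset.univ_nonempty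
    refine ⟨x, Finset.mem_filter.mpr ⟨Finset.mem_univ _, ?_⟩⟩
    rw [Finset.filter_eq_empty_iff.mpr]
    · simp
    · intro v _
      exact not_lt.mpr (hx v (Finset.mem_univ _))
  obtain ⟨x, hxT, hx⟩ := T.exists_min_image f hT
  refine ⟨f x, (Finset.mem_filter.mp hxT).2, ?_⟩
  rcases (Finset.univ.filter fun v => f v < f x).eq_empty_or_nonempty with he | hne
  · rw [he]; simp
  obtain ⟨y, hy, hymax⟩ := Finset.exists_max_image _ f hne
  have hyx : f y < f x := (Finset.mem_filter.mp hy).2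
  have hyT : y ∉ T := fun h => absurd (hx y h) (not_le.mpr hyx)
  have hlt : Fintype.card V < 2 * (Finset.univ.filter fun v => f y < f v).card := by
    by_contra h
    exact hyT (Finset.mem_filter.mpr ⟨Finset.mem_univ _, not_lt.mp h⟩)
  have hdisj : Disjoint (Finset.univ.filter fun v => f v < f x)
      (Finset.univ.filter fun v => f y < f v) := by
    rw [Finset.disjoint_left]
    intro v hv hv'
    exact absurd (hymax v hv) (not_le.mpr (Finset.mem_filter.mp hv').2)
  have := Finset.card_union_of_disjoint hdisj
  have h2 := Finset.card_le_univ ((Finset.univ.filter fun v => f v < f x) ∪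
    (Finset.univ.filter fun v => f y < f v))
  omega

theorem abs_max_sub_add_abs_max_sub_le (a b c : ℝ) :
    |max (a - c) 0 - max (b - c) 0| + |max (c - a) 0 - max (c - b) 0| ≤ |a - b| := by
  grind

/-- For a median c, both parts (h − c)⁺ and (h − c)⁻ are supported on at most half of the vertices,
and their variations add up to at most that of h. -/
theorem exists_edgeExpansion_mul_sum_abs_le (G : RegularWeightedGraph V) [Nonempty V]
    (h : V → ℝ) : ∃ c, G.edgeExpansion * ∑ v, |h v - c| ≤ G.variation h := by
  obtain ⟨c, hc1, hc2⟩ := exists_median h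
  refine ⟨c, ?_⟩
  have h1 := G.edgeExpansion_mul_sum_le_variation (fun v => max (h v - c) 0)
    (fun v => le_max_right _ _) (by
      refine le_trans (Nat.mul_le_mul_left 2 (Finset.card_le_card fun v hv => ?_)) hc1
      simp only [Finset.mem_filter, Finset.mem_univ, true_and] at hv ⊢
      by_contra h'
      exact hv (max_eq_right (by linarith)))
  have h2 := G.edgeExpansion_mul_sum_le_variation (fun v => max (c - h v) 0)
    (fun v => le_max_right _ _) (by
      refine le_trans (Nat.mul_le_mul_left 2 (Finset.card_le_card fun v hv => ?_)) hc2
      simp only [Finset.mem_filter, Finset.mem_univ, true_and] at hv ⊢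
      by_contra h'
      exact hv (max_eq_right (by linarith)))
  have h3 : ∑ v, |h v - c| = ∑ v, max (h v - c) 0 + ∑ v, max (c - h v) 0 := by
    rw [← Finset.sum_add_distrib]
    refine Finset.sum_congr rfl fun v _ => ?_
    rcases le_total (h v) c with hv | hv
    · rw [max_eq_right (by linarith), max_eq_left (by linarith), abs_of_nonpos (by linarith)]
      ring
    · rw [max_eq_left (by linarith), max_eq_right (by linarith), abs_of_nonneg (by linarith)]
      ring
  have h4 : G.variation (fun v => max (h v - c) 0) + G.variation (fun v => max (c - h v) 0) ≤
      G.variation h := by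
    unfold variation
    rw [← add_div, ← Finset.sum_add_distrib]
    refine div_le_div_of_nonneg_right (Finset.sum_le_sum fun u _ => ?_) zero_le_two
    rw [← Finset.sum_add_distrib]
    refine Finset.sum_le_sum fun v _ => ?_
    rw [← mul_add]
    refine mul_le_mul_of_nonneg_left ?_ (G.nonneg u v)
    exact abs_max_sub_add_abs_max_sub_le (h u) (h v) c
  rw [h3, mul_add]
  linarith

/-- A nonnegative function supported on at most half of the vertices whose Rayleigh quotient is
at most `λ₂`. -/
theorem exists_nonneg_energy_le (G : RegularWeightedGraph V) (hV : 2 ≤ Fintype.card V) :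
    ∃ f : V → ℝ, (∀ v, 0 ≤ f v) ∧ 0 < f ⬝ᵥ f ∧
      2 * (Finset.univ.filter fun v => f v ≠ 0).card ≤ Fintype.card V ∧
      G.energy f ≤ G.lambda 2 * (f ⬝ᵥ f) := by
  obtain ⟨f, hf0, hfs, hfE⟩ := G.exists_sum_eq_zero_energy_le hV
  have : Nonempty V := Fintype.card_pos_iff.mp (by omega)
  obtain ⟨c, hc1, hc2⟩ := exists_median f
  have hpos : 0 < f ⬝ᵥ f := by
    have := dotProduct_star_self_pos_iff (v := f)
    simpa using this.mpr hf0
  have hl := (G.lambda_mem_Icc 2).1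
  set p : V → ℝ := fun v => max (f v - c) 0 with hp
  set q : V → ℝ := fun v => max (c - f v) 0 with hq
  -- Since f has mean zero, shifting it by the median c can only increase the norm, while the
  -- energies of the two parts sum to at most that of f. So one of the parts keeps the Rayleigh
  -- quotient; the other may vanish.
  have hpq : f ⬝ᵥ f ≤ p ⬝ᵥ p + q ⬝ᵥ q := by
    have h1 : p ⬝ᵥ p + q ⬝ᵥ q = ∑ v, (f v - c) ^ 2 := by
      simp only [dotProduct, ← Finset.sum_add_distrib]
      refine Finset.sum_congr rfl fun v _ => ?_
      rcases le_total (f v) c with hv | hv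
      · simp only [hp, hq]
        rw [max_eq_right (by linarith), max_eq_left (by linarith)]
        ring
      · simp only [hp, hq]
        rw [max_eq_left (by linarith), max_eq_right (by linarith)]
        ring
    have h2 : ∑ v, (f v - c) ^ 2 = f ⬝ᵥ f - 2 * c * ∑ v, f v + ∑ _v : V, c ^ 2 := by
      simp only [dotProduct, Finset.mul_sum, ← Finset.sum_add_distrib, ← Finset.sum_sub_distrib]
      exact Finset.sum_congr rfl fun v _ => by ring
    have h3 : (0 : ℝ) ≤ ∑ _v : V, c ^ 2 := Finset.sum_nonneg fun _ _ => sq_nonneg c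
    rw [h1, h2, hfs]
    linarith
  have hE : G.energy p + G.energy q ≤ G.energy f := by
    unfold energy
    rw [← add_div, ← Finset.sum_add_distrib]
    refine div_le_div_of_nonneg_right (Finset.sum_le_sum fun u _ => ?_) zero_le_two
    rw [← Finset.sum_add_distrib]
    refine Finset.sum_le_sum fun v _ => ?_
    rw [← mul_add]
    refine mul_le_mul_of_nonneg_left ?_ (G.nonneg u v)
    simp only [hp, hq]
    rcases le_total (f u) c with hu | hu <;> rcases le_total (f v) c with hv | hv <;>
    · first
      | rw [max_eq_right (by linarith : f u - c ≤ 0), max_eq_left (by linarith : 0 ≤ c - f u)]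
      | rw [max_eq_left (by linarith : 0 ≤ f u - c), max_eq_right (by linarith : c - f u ≤ 0)]
      first
      | rw [max_eq_right (by linarith : f v - c ≤ 0), max_eq_left (by linarith : 0 ≤ c - f v)]
      | rw [max_eq_left (by linarith : 0 ≤ f v - c), max_eq_right (by linarith : c - f v ≤ 0)]
      nlinarith [mul_nonneg (sub_nonneg.mpr hu) (sub_nonneg.mpr hv)]
  have hps : 2 * (Finset.univ.filter fun v => p v ≠ 0).card ≤ Fintype.card V := by
    refine le_trans (Nat.mul_le_mul_left 2 (Finset.card_le_card fun v hv => ?_)) hc1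
    simp only [Finset.mem_filter, Finset.mem_univ, true_and] at hv ⊢
    by_contra h'
    exact hv (max_eq_right (by linarith))
  have hqs : 2 * (Finset.univ.filter fun v => q v ≠ 0).card ≤ Fintype.card V := by
    refine le_trans (Nat.mul_le_mul_left 2 (Finset.card_le_card fun v hv => ?_)) hc2
    simp only [Finset.mem_filter, Finset.mem_univ, true_and] at hv ⊢
    by_contra h'
    exact hv (max_eq_right (by linarith))
  have hp0 : 0 ≤ p ⬝ᵥ p := Finset.sum_nonneg fun v _ => mul_self_nonneg _
  have hq0 : 0 ≤ q ⬝ᵥ q := Finset.sum_nonneg fun v _ => mul_self_nonneg _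
  have hEp := G.energy_nonneg p
  have hEq := G.energy_nonneg q
  have htot : G.energy p + G.energy q ≤ G.lambda 2 * (p ⬝ᵥ p) + G.lambda 2 * (q ⬝ᵥ q) := by
    nlinarith
  by_cases hgood : 0 < p ⬝ᵥ p ∧ G.energy p ≤ G.lambda 2 * (p ⬝ᵥ p)
  · exact ⟨p, fun v => le_max_right _ _, hgood.1, hps, hgood.2⟩
  have hbad : G.lambda 2 * (p ⬝ᵥ p) ≤ G.energy p := by
    by_contra h'
    push Not at h'
    refine hgood ⟨lt_of_le_of_ne hp0 fun h0 => ?_, h'.le⟩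
    rw [← h0] at h'
    linarith
  refine ⟨q, fun v => le_max_right _ _, ?_, hqs, by linarith⟩
  by_contra hq'
  have hq1 : q ⬝ᵥ q = 0 := le_antisymm (not_lt.mp hq') hq0
  refine hgood ⟨by linarith, ?_⟩
  rw [hq1] at htot
  linarith

omit [DecidableEq V] in
/-- The Cauchy–Schwarz step of the rounding arguments. -/
theorem variation_le_of_abs_sub_le (G : RegularWeightedGraph V) {f h d : V → ℝ} {K : ℝ}
    (hK : 0 ≤ K) (hh : ∀ u v, |h u - h v| ≤ K * (|f u - f v| * (|f u - f v| + d u))) :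
    G.variation h ≤ K * (G.energy f + √(2 * G.energy f) * √(d ⬝ᵥ d) / 2) := by
  have h1 : ∑ u, ∑ v, G.weight u v * |h u - h v| ≤
      K * (∑ u, ∑ v, G.weight u v * (f u - f v) ^ 2) +
        K * ∑ u, ∑ v, G.weight u v * (|f u - f v| * d u) := by
    simp only [Finset.mul_sum, ← Finset.sum_add_distrib]
    refine Finset.sum_le_sum fun u _ => Finset.sum_le_sum fun v _ => ?_
    refine (mul_le_mul_of_nonneg_left (hh u v) (G.nonneg u v)).trans (le_of_eq ?_)
    rw [← sq_abs (f u - f v)]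
    ring
  have hd : ∑ u, ∑ v, G.weight u v * d u ^ 2 = d ⬝ᵥ d := by
    rw [G.sum_sum_weight_mul_left]
    simp only [dotProduct, sq]
  have h2 : ∑ u, ∑ v, G.weight u v * (|f u - f v| * d u) ≤
      √(2 * G.energy f) * √(d ⬝ᵥ d) := by
    have := Real.sum_mul_le_sqrt_mul_sqrt (Finset.univ : Finset (V × V))
      (fun x => √(G.weight x.1 x.2) * |f x.1 - f x.2|) (fun x => √(G.weight x.1 x.2) * d x.1)
    rw [Fintype.sum_prod_type, Fintype.sum_prod_type, Fintype.sum_prod_type] at this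
    simp only [mul_pow, Real.sq_sqrt (G.nonneg _ _), sq_abs] at this
    rw [hd] at this
    convert this using 2
    · refine Finset.sum_congr rfl fun v _ => ?_
      rw [mul_mul_mul_comm, Real.mul_self_sqrt (G.nonneg _ _)]
    · rw [energy]
      congr 1
      ring
  have h3 : ∑ u, ∑ v, G.weight u v * (f u - f v) ^ 2 = 2 * G.energy f := by
    rw [energy]; ring
  rw [variation]
  rw [h3] at h1
  nlinarith [mul_le_mul_of_nonneg_left h2 hK]

/-- Cheeger's inequality. -/
theorem edgeExpansion_le_sqrt (G : RegularWeightedGraph V) (hV : 2 ≤ Fintype.card V) :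
    G.edgeExpansion ≤ √(2 * G.lambda 2) := by
  obtain ⟨f, hf0, hpos, hs, hE⟩ := G.exists_nonneg_energy_le hV
  -- The classical rounding: coarea for f², then Cauchy–Schwarz on |f u − f v|·|f u + f v|.
  have h1 := G.edgeExpansion_mul_sum_le_variation (fun v => f v ^ 2) (fun v => sq_nonneg _) (by
    simpa using hs)
  have hsum : ∑ v, f v ^ 2 = f ⬝ᵥ f := by simp only [dotProduct, sq]
  rw [hsum] at h1
  have h2 : ∑ u, ∑ v, G.weight u v * |f u ^ 2 - f v ^ 2| ≤
      √(2 * G.energy f) * √(4 * (f ⬝ᵥ f)) := by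
    have := Real.sum_mul_le_sqrt_mul_sqrt (Finset.univ : Finset (V × V))
      (fun x => √(G.weight x.1 x.2) * |f x.1 - f x.2|)
      (fun x => √(G.weight x.1 x.2) * |f x.1 + f x.2|)
    rw [Fintype.sum_prod_type, Fintype.sum_prod_type, Fintype.sum_prod_type] at this
    simp only [mul_pow, Real.sq_sqrt (G.nonneg _ _), sq_abs] at this
    have hle : ∑ u, ∑ v, G.weight u v * (f u + f v) ^ 2 ≤ 4 * (f ⬝ᵥ f) := by
      have e1 := G.sum_sum_weight_mul_left (fun u => f u ^ 2)
      have e2 := G.sum_sum_weight_mul_right (fun u => f u ^ 2)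
      rw [hsum] at e1 e2
      have : 4 * (f ⬝ᵥ f) = 2 * (∑ u, ∑ v, G.weight u v * f u ^ 2) +
          2 * (∑ u, ∑ v, G.weight u v * f v ^ 2) := by rw [e1, e2]; ring
      rw [this]
      simp only [Finset.mul_sum, ← Finset.sum_add_distrib]
      refine Finset.sum_le_sum fun u _ => Finset.sum_le_sum fun v _ => ?_
      nlinarith [mul_nonneg (G.nonneg u v) (sq_nonneg (f u - f v))]
    have h3 : ∑ u, ∑ v, G.weight u v * (f u - f v) ^ 2 = 2 * G.energy f := by
      rw [energy]; ring
    rw [h3] at this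
    refine le_trans (le_of_eq ?_) (this.trans (mul_le_mul_of_nonneg_left
      (Real.sqrt_le_sqrt hle) (Real.sqrt_nonneg _)))
    refine Finset.sum_congr rfl fun u _ => Finset.sum_congr rfl fun v _ => ?_
    rw [mul_mul_mul_comm, Real.mul_self_sqrt (G.nonneg _ _), ← abs_mul]
    congr 2
    ring
  have h4 : √(2 * G.energy f) * √(4 * (f ⬝ᵥ f)) ≤ 2 * (√(2 * G.lambda 2) * (f ⬝ᵥ f)) := by
    rw [← Real.sqrt_mul (by have := G.energy_nonneg f; linarith)]
    have hl := (G.lambda_mem_Icc 2).1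
    refine Real.sqrt_le_iff.mpr ⟨by positivity, ?_⟩
    rw [mul_pow, mul_pow, Real.sq_sqrt (by linarith)]
    nlinarith
  rw [variation] at h1
  refine le_of_mul_le_mul_right ?_ hpos
  linarith

end RegularWeightedGraph

/-! ### Tents between thresholds. -/

/-- The tent function over `[s, t]`: the distance to the complement of the interval. -/
noncomputable def tent (s t x : ℝ) : ℝ := max 0 (min (x - s) (t - x))

theorem tent_ne_zero {s t x : ℝ} (h : tent s t x ≠ 0) : s < x ∧ x < t := by
  unfold tent at h
  by_contra h'
  refine h (max_eq_left ?_)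
  by_cases hs : s < x
  · exact min_le_of_right_le (by linarith [not_lt.mp fun ht => h' ⟨hs, ht⟩])
  · exact min_le_of_left_le (by linarith)

/-- The tent is 1-Lipschitz and vanishes outside [s, t]; the right-hand side is the length of [y, x]
∩ [s, t], a form that telescopes over consecutive intervals. -/
theorem abs_tent_sub_tent_le {s t x y : ℝ} (hst : s ≤ t) (hxy : y ≤ x) :
    |tent s t x - tent s t y| ≤ (min x t - min x s) - (min y t - min y s) := by
  unfold tent
  grind

/-- The tents over consecutive intervals form a contraction into `ℓ²`. -/
theorem sum_tent_sub_sq_le {t : ℕ → ℝ} (ht : Monotone t) (N : ℕ) (x y : ℝ) :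
    ∑ i ∈ Finset.range N, (tent (t i) (t (i + 1)) x - tent (t i) (t (i + 1)) y) ^ 2 ≤
      (x - y) ^ 2 := by
  wlog hxy : y ≤ x generalizing x y
  · have := this y x (le_of_not_ge hxy)
    rw [← neg_sub x y, neg_sq] at this
    refine le_trans (le_of_eq (Finset.sum_congr rfl fun i _ => ?_)) this
    ring
  have h1 : ∑ i ∈ Finset.range N, |tent (t i) (t (i + 1)) x - tent (t i) (t (i + 1)) y| ≤
      x - y := by
    have h2 : ∑ i ∈ Finset.range N, |tent (t i) (t (i + 1)) x - tent (t i) (t (i + 1)) y| ≤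
        ∑ i ∈ Finset.range N, ((min x (t (i + 1)) - min y (t (i + 1))) -
          (min x (t i) - min y (t i))) := by
      refine Finset.sum_le_sum fun i _ => ?_
      have := abs_tent_sub_tent_le (ht (Nat.le_succ i)) hxy
      simp only [Nat.succ_eq_add_one] at this
      linarith
    rw [Finset.sum_range_sub (fun i => min x (t i) - min y (t i))] at h2
    refine h2.trans ?_
    grind
  have h3 : ∑ i ∈ Finset.range N, (tent (t i) (t (i + 1)) x - tent (t i) (t (i + 1)) y) ^ 2 ≤
      (∑ i ∈ Finset.range N, |tent (t i) (t (i + 1)) x - tent (t i) (t (i + 1)) y|) ^ 2 := by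
    have := Finset.sum_sq_le_sq_sum_of_nonneg (s := Finset.range N)
      (f := fun i => |tent (t i) (t (i + 1)) x - tent (t i) (t (i + 1)) y|)
      fun i _ => abs_nonneg _
    simpa only [sq_abs] using this
  exact h3.trans (pow_le_pow_left₀ (Finset.sum_nonneg fun _ _ => abs_nonneg _) h1 2)

/-- Intermediate value theorem: the squared norm grows continuously from 0 at t = s. If it is still
at most C at a t beyond all values of f, that t is taken. -/
theorem exists_tent_threshold {V : Type*} [Fintype V] (f : V → ℝ) {C : ℝ} (hC : 0 ≤ C) (s : ℝ) :
    ∃ t, s ≤ t ∧ ∑ v, tent s t (f v) ^ 2 ≤ C ∧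
      (∑ v, tent s t (f v) ^ 2 = C ∨ ∀ v, f v ≤ t) := by
  obtain ⟨M, hM⟩ := (Set.finite_range f).bddAbove
  have hM' : ∀ v, f v ≤ max s M := fun v => (hM ⟨v, rfl⟩).trans (le_max_right _ _)
  by_cases h : ∑ v, tent s (max s M) (f v) ^ 2 ≤ C
  · exact ⟨max s M, le_max_left _ _, h, Or.inr hM'⟩
  have hcont : ContinuousOn (fun t => ∑ v, tent s t (f v) ^ 2) (Set.Icc s (max s M)) := by
    unfold tent
    fun_prop
  have h0 : ∑ v, tent s s (f v) ^ 2 = 0 := by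
    refine Finset.sum_eq_zero fun v _ => ?_
    have : tent s s (f v) = 0 := by
      by_contra h'
      have := tent_ne_zero h'
      linarith
    rw [this]
    norm_num
  obtain ⟨t, ht, hCt⟩ := intermediate_value_Icc (le_max_left s M) hcont
    ⟨(h0.trans_le hC : _ ≤ C), (not_le.mp h).le⟩
  exact ⟨t, ht.1, le_of_eq hCt, Or.inl hCt⟩

/-- Iterate the greedy choice from 0. A step that does not use up C has passed every value of f, and
all later thresholds lie beyond it. -/
theorem exists_tent_thresholds {V : Type*} [Fintype V] (f : V → ℝ) {C : ℝ} (hC : 0 ≤ C)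
    (N : ℕ) :
    ∃ t : ℕ → ℝ, Monotone t ∧ t 0 = 0 ∧ (∀ i, ∑ v, tent (t i) (t (i + 1)) (f v) ^ 2 ≤ C) ∧
      ((∀ i < N, ∑ v, tent (t i) (t (i + 1)) (f v) ^ 2 = C) ∨ ∀ v, f v ≤ t N) := by
  choose step h1 h2 h3 using exists_tent_threshold f hC
  let t : ℕ → ℝ := fun i => step^[i] 0
  have hs : ∀ i, t (i + 1) = step (t i) := fun i => Function.iterate_succ_apply' step i 0
  have hm : Monotone t := monotone_nat_of_le_succ fun i => by rw [hs]; exact h1 _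
  refine ⟨t, hm, rfl, fun i => by rw [hs]; exact h2 _, ?_⟩
  by_cases h : ∀ i < N, ∑ v, tent (t i) (t (i + 1)) (f v) ^ 2 = C
  · exact Or.inl h
  · push Not at h
    obtain ⟨i, hi, hne⟩ := h
    rw [hs] at hne
    refine Or.inr fun v => ((h3 (t i)).resolve_left hne v).trans ?_
    rw [← hs]
    exact hm hi

/-- The distance to the nearest of the thresholds is controlled by the tents between them. -/
theorem infDist_sq_le_sum_tent_sq {t : ℕ → ℝ} (ht0 : t 0 = 0) {N : ℕ} {x : ℝ}
    (hx0 : 0 ≤ x) (hxN : x ≤ t N) :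
    Metric.infDist x ((Finset.range (N + 1)).image t : Finset ℝ) ^ 2 ≤
      ∑ i ∈ Finset.range N, tent (t i) (t (i + 1)) x ^ 2 := by
  have hmem : ∀ i ≤ N, t i ∈ ((Finset.range (N + 1)).image t : Finset ℝ) := fun i hi =>
    Finset.mem_image_of_mem t (Finset.mem_range.mpr (by omega))
  have hex : ∃ i, x ≤ t i := ⟨N, hxN⟩
  classical
  -- The first threshold at or above x and its predecessor enclose x; on that interval the tent is
  -- the distance to the nearer endpoint.
  rcases Nat.eq_zero_or_pos (Nat.find hex) with hz | hpos
  · have hx : x = t 0 := le_antisymm (hz ▸ Nat.find_spec hex) (ht0 ▸ hx0)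
    rw [hx, Metric.infDist_zero_of_mem (hmem 0 (Nat.zero_le _))]
    simpa using Finset.sum_nonneg fun i _ => sq_nonneg _
  · obtain ⟨i, hi⟩ := Nat.exists_eq_succ_of_ne_zero hpos.ne'
    have hiN : i + 1 ≤ N := hi.symm.trans_le (Nat.find_min' hex hxN)
    have h1 : t i < x := not_le.mp (Nat.find_min hex (by omega))
    have h2 : x ≤ t (i + 1) := (congrArg (fun j => x ≤ t j) hi).mp (Nat.find_spec hex)
    have hle : Metric.infDist x ((Finset.range (N + 1)).image t : Finset ℝ) ≤
        tent (t i) (t (i + 1)) x := by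
      refine le_max_of_le_right (le_min ?_ ?_)
      · refine (Metric.infDist_le_dist_of_mem (hmem i (by omega))).trans ?_
        rw [Real.dist_eq, abs_of_nonneg (by linarith)]
      · refine (Metric.infDist_le_dist_of_mem (hmem (i + 1) hiN)).trans ?_
        rw [Real.dist_eq, abs_of_nonpos (by linarith)]
        linarith
    refine (pow_le_pow_left₀ Metric.infDist_nonneg hle 2).trans ?_
    exact Finset.single_le_sum (f := fun i => tent (t i) (t (i + 1)) x ^ 2)
      (fun j _ => sq_nonneg _) (Finset.mem_range.mpr (by omega))

/-! ### Rounding by the integrated distance to a finite set. -/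

/-- The integral from `0` to `y` of the distance to `T`. -/
noncomputable def integralInfDist (T : Set ℝ) (y : ℝ) : ℝ := ∫ x in (0 : ℝ)..y, Metric.infDist x T

theorem integralInfDist_nonneg (T : Set ℝ) {y : ℝ} (hy : 0 ≤ y) : 0 ≤ integralInfDist T y :=
  intervalIntegral.integral_nonneg hy fun _ _ => Metric.infDist_nonneg

/-- The integrand is 1-Lipschitz, so between a and b it is at most its value at a plus |a − b|. -/
theorem abs_integralInfDist_sub_le (T : Set ℝ) (a b : ℝ) :
    |integralInfDist T a - integralInfDist T b| ≤ |a - b| * (|a - b| + Metric.infDist a T) := by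
  have hi : ∀ x y, IntervalIntegrable (fun x => Metric.infDist x T) MeasureTheory.volume x y :=
    fun x y => (Metric.continuous_infDist_pt T).intervalIntegrable x y
  rw [integralInfDist, integralInfDist, intervalIntegral.integral_interval_sub_left (hi _ _) (hi _ _)]
  have := intervalIntegral.norm_integral_le_of_norm_le_const (a := b) (b := a)
    (C := |a - b| + Metric.infDist a T) (f := fun x => Metric.infDist x T) (by
      intro x hx
      rw [Real.norm_of_nonneg Metric.infDist_nonneg]
      refine Metric.infDist_le_infDist_add_dist (x := x) (y := a) |>.trans ?_
      have : dist x a ≤ |a - b| := by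
        rw [Real.dist_eq, abs_sub_comm]
        have := Set.abs_sub_right_of_mem_uIcc (Set.uIoc_subset_uIcc hx)
        grind
      linarith)
  rw [Real.norm_eq_abs] at this
  linarith

/-- Balls of radius y/(4|T|) about T cover at most half of the interval from 0 to y; on the rest the
integrand is at least that radius. -/
theorem sq_div_le_integralInfDist (T : Finset ℝ) (hT : T.Nonempty) {y : ℝ} (hy : 0 ≤ y) :
    y ^ 2 / (8 * T.card) ≤ integralInfDist T y := by
  have hn : (0 : ℝ) < T.card := by exact_mod_cast hT.card_pos
  set a : ℝ := y / (4 * T.card) with ha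
  have ha0 : 0 ≤ a := by positivity
  have hay : T.card * (2 * a) = y / 2 := by rw [ha]; field_simp; ring
  let B : Set ℝ := ⋃ τ ∈ T, Metric.ball τ a
  have hBm : MeasurableSet B := Finset.measurableSet_biUnion T fun τ _ => measurableSet_ball
  have hB : MeasureTheory.volume.real B ≤ y / 2 := by
    rw [← hay]
    refine (MeasureTheory.measureReal_biUnion_finset_le T _).trans ?_
    refine (Finset.sum_le_card_nsmul T _ (2 * a) fun τ _ => ?_).trans (by rw [nsmul_eq_mul])
    rw [Real.volume_real_ball ha0]
  have hBfin : MeasureTheory.volume B ≠ ⊤ := by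
    refine ((MeasureTheory.measure_biUnion_finset_le T _).trans_lt ?_).ne
    exact ENNReal.sum_lt_top.mpr fun τ _ => by rw [Real.volume_ball]; exact ENNReal.ofReal_lt_top
  have hdiff : y / 2 ≤ MeasureTheory.volume.real (Set.Ioc 0 y \ B) := by
    have := MeasureTheory.le_measureReal_sdiff (μ := MeasureTheory.volume)
      (s₁ := Set.Ioc 0 y) (s₂ := B) hBfin
    rw [Real.volume_real_Ioc_of_le hy] at this
    linarith
  have hint : MeasureTheory.IntegrableOn (fun x => Metric.infDist x (T : Set ℝ)) (Set.Ioc 0 y) :=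
    ((Metric.continuous_infDist_pt _).intervalIntegrable 0 y).1
  have h1 : a * MeasureTheory.volume.real (Set.Ioc 0 y \ B) ≤ integralInfDist T y := by
    rw [integralInfDist, intervalIntegral.integral_of_le hy]
    calc a * MeasureTheory.volume.real (Set.Ioc 0 y \ B)
        = ∫ _x in Set.Ioc 0 y \ B, a := by
          rw [MeasureTheory.setIntegral_const, smul_eq_mul, mul_comm]
      _ ≤ ∫ x in Set.Ioc 0 y \ B, Metric.infDist x (T : Set ℝ) := by
          refine MeasureTheory.setIntegral_mono_on ?_ (hint.mono_set Set.sdiff_subset)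
            (measurableSet_Ioc.diff hBm) fun x hx => ?_
          · exact MeasureTheory.integrableOn_const (ne_of_lt (lt_of_le_of_lt
              (MeasureTheory.measure_mono Set.sdiff_subset) measure_Ioc_lt_top))
          · refine (Metric.le_infDist (by exact_mod_cast hT)).mpr fun {τ} hτ => ?_
            by_contra h'
            exact hx.2 (Set.mem_biUnion (Finset.mem_coe.mp hτ) (not_le.mp h'))
      _ ≤ ∫ x in Set.Ioc 0 y, Metric.infDist x (T : Set ℝ) :=
          MeasureTheory.setIntegral_mono_set hint
            (Filter.Eventually.of_forall fun _ => Metric.infDist_nonneg)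
            (Filter.Eventually.of_forall Set.sdiff_subset)
  refine le_trans (le_of_eq ?_) ((mul_le_mul_of_nonneg_left hdiff ha0).trans h1)
  rw [ha]
  field_simp
  ring

namespace RegularWeightedGraph

variable {V : Type u} [Fintype V] [DecidableEq V]

open Matrix

/-! ### Step approximation and the improved Cheeger inequality. -/

/-- Disjointly supported functions of energy at most `E` and squared norm `C` bound `λ_k`. -/
theorem lambda_le_of_disjoint (G : RegularWeightedGraph V) {k : ℕ} (h1 : 1 ≤ k)
    (hk : k ≤ Fintype.card V) {ι : Type*} [Fintype ι] (hι : k ≤ Fintype.card ι) {F : ι → V → ℝ}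
    (hF : ∀ v i j, F i v ≠ 0 → F j v ≠ 0 → i = j) {C E : ℝ} (hC : 0 < C)
    (hFC : ∀ i, F i ⬝ᵥ F i = C) (hFE : ∀ i, G.energy (F i) ≤ E) :
    G.lambda k ≤ 2 * E / C := by
  classical
  have horth : ∀ i j, F i ⬝ᵥ F j = if i = j then C else 0 := by
    intro i j
    split_ifs with hij
    · rw [← hij, hFC]
    · refine Finset.sum_eq_zero fun v _ => ?_
      by_contra h
      exact hij (hF v i j (left_ne_zero_of_mul h) (right_ne_zero_of_mul h))
  have hli : LinearIndependent ℝ F := by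
    rw [Fintype.linearIndependent_iff]
    intro c hc i
    have := congrArg (fun f => F i ⬝ᵥ f) hc
    simpa [dotProduct_sum, horth, hC.ne'] using this
  refine G.lambda_le_of_linearIndependent h1 hk hι hli fun c => ?_
  have hnorm : (∑ i, c i • F i) ⬝ᵥ (∑ i, c i • F i) = C * ∑ i, c i ^ 2 := by
    simp only [sum_dotProduct, dotProduct_sum, smul_dotProduct, dotProduct_smul, horth,
      smul_eq_mul, Finset.mul_sum]
    refine Finset.sum_congr rfl fun i _ => ?_
    simp
    ring
  have hen : G.energy (∑ i, c i • F i) ≤ 2 * ∑ i, c i ^ 2 * G.energy (F i) := by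
    -- At most one of the functions is nonzero at u and at most one at v, so only two terms survive:
    -- hence the factor 2.
    have hpt : ∀ u v, ((∑ i, c i • F i) u - (∑ i, c i • F i) v) ^ 2 ≤
        2 * ∑ i, c i ^ 2 * (F i u - F i v) ^ 2 := by
      intro u v
      let s := Finset.univ.filter fun i => F i u ≠ 0
      let s' := Finset.univ.filter fun i => F i v ≠ 0
      have hs : s.card ≤ 1 := Finset.card_le_one.mpr fun i hi j hj =>
        hF u i j (Finset.mem_filter.mp hi).2 (Finset.mem_filter.mp hj).2
      have hs' : s'.card ≤ 1 := Finset.card_le_one.mpr fun i hi j hj =>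
        hF v i j (Finset.mem_filter.mp hi).2 (Finset.mem_filter.mp hj).2
      have hcard : ((s ∪ s').card : ℝ) ≤ 2 := by
        have := Finset.card_union_le s s'
        exact_mod_cast (by omega : (s ∪ s').card ≤ 2)
      have hsum : (∑ i, c i • F i) u - (∑ i, c i • F i) v =
          ∑ i ∈ s ∪ s', c i * (F i u - F i v) := by
        rw [Finset.sum_apply, Finset.sum_apply, ← Finset.sum_sub_distrib]
        symm
        refine (Finset.sum_subset (Finset.subset_univ _) fun i _ hi => ?_).trans
          (Finset.sum_congr rfl fun i _ => ?_)
        · simp only [s, s', Finset.mem_union, Finset.mem_filter, Finset.mem_univ, true_and,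
            not_or, not_not] at hi
          rw [hi.1, hi.2]; ring
        · simp only [Pi.smul_apply, smul_eq_mul]; ring
      rw [hsum]
      refine sq_sum_le_card_mul_sum_sq.trans ?_
      refine mul_le_mul hcard ?_ (Finset.sum_nonneg fun _ _ => sq_nonneg _) zero_le_two
      simp only [mul_pow]
      exact Finset.sum_le_sum_of_subset_of_nonneg (Finset.subset_univ _)
        fun _ _ _ => by positivity
    calc G.energy (∑ i, c i • F i)
        ≤ (∑ u, ∑ v, G.weight u v * (2 * ∑ i, c i ^ 2 * (F i u - F i v) ^ 2)) / 2 := by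
          refine div_le_div_of_nonneg_right (Finset.sum_le_sum fun u _ =>
            Finset.sum_le_sum fun v _ => ?_) zero_le_two
          exact mul_le_mul_of_nonneg_left (hpt u v) (G.nonneg u v)
      _ = 2 * ∑ i, c i ^ 2 * G.energy (F i) := by
          simp only [energy, Finset.mul_sum, Finset.sum_div]
          rw [Finset.sum_comm' (t' := Finset.univ) (s' := fun _ => Finset.univ) (by simp)]
          symm
          rw [Finset.sum_comm]
          refine (Finset.sum_congr rfl fun u _ => Finset.sum_comm).trans ?_
          rw [Finset.sum_comm]
          refine Finset.sum_congr rfl fun v _ => Finset.sum_congr rfl fun u _ =>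
            Finset.sum_congr rfl fun i _ => ?_
          ring
  rw [hnorm]
  have hle : ∑ i, c i ^ 2 * G.energy (F i) ≤ E * ∑ i, c i ^ 2 := by
    rw [Finset.mul_sum]
    refine Finset.sum_le_sum fun i _ => ?_
    rw [mul_comm E]
    exact mul_le_mul_of_nonneg_left (hFE i) (sq_nonneg _)
  have : 2 * E / C * (C * ∑ i, c i ^ 2) = 2 * (E * ∑ i, c i ^ 2) := by
    field_simp
  linarith

omit [DecidableEq V] in
theorem sum_energy_tent_le (G : RegularWeightedGraph V) (f : V → ℝ) {t : ℕ → ℝ}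
    (ht : Monotone t) (N : ℕ) :
    ∑ i ∈ Finset.range N, G.energy (fun v => tent (t i) (t (i + 1)) (f v)) ≤ G.energy f := by
  unfold energy
  rw [← Finset.sum_div, Finset.sum_comm]
  refine div_le_div_of_nonneg_right (Finset.sum_le_sum fun u _ => ?_) zero_le_two
  rw [Finset.sum_comm]
  refine Finset.sum_le_sum fun v _ => ?_
  rw [← Finset.mul_sum]
  exact mul_le_mul_of_nonneg_left (sum_tent_sub_sq_le ht N _ _) (G.nonneg u v)

/-- A nonnegative function is close to a step function with `2k + 1` values. -/
theorem exists_step_approximation (G : RegularWeightedGraph V) {k : ℕ} (h1 : 1 ≤ k)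
    (hk : k ≤ Fintype.card V) (hlam : 0 < G.lambda k) {f : V → ℝ} (hf : ∀ v, 0 ≤ f v)
    (hE : 0 < G.energy f) :
    ∃ T : Finset ℝ, T.Nonempty ∧ T.card ≤ 2 * k + 1 ∧
      ∑ v, Metric.infDist (f v) T ^ 2 ≤ 8 * G.energy f / G.lambda k := by
  have hk0 : (0 : ℝ) < k := by exact_mod_cast h1
  -- With this C, k disjoint tents of energy at most E/k would give λ_k ≤ λ_k/2, and otherwise the
  -- total squared distance is at most 2kC = 8E/λ_k.
  set C : ℝ := 4 * G.energy f / (k * G.lambda k) with hCdef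
  have hC : 0 < C := by positivity
  obtain ⟨t, hm, ht0, htC, hcase⟩ := exists_tent_thresholds f hC.le (2 * k)
  rcases hcase with hEq | hmax
  · exfalso
    let e : ℕ → ℝ := fun i => G.energy (fun v => tent (t i) (t (i + 1)) (f v))
    let good := (Finset.range (2 * k)).filter fun i => e i ≤ G.energy f / k
    let bad := (Finset.range (2 * k)).filter fun i => ¬ e i ≤ G.energy f / k
    have hbad : bad.card ≤ k := by
      have h2 : bad.card • (G.energy f / k) ≤ G.energy f := by
        refine (Finset.card_nsmul_le_sum bad e _ fun i hi => ?_).trans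
          ((Finset.sum_le_sum_of_subset_of_nonneg (Finset.filter_subset _ _)
            fun i _ _ => G.energy_nonneg _).trans (G.sum_energy_tent_le f hm (2 * k)))
        exact (not_le.mp (Finset.mem_filter.mp hi).2).le
      rw [nsmul_eq_mul, mul_div_assoc', div_le_iff₀ hk0, mul_comm] at h2
      exact_mod_cast le_of_mul_le_mul_left h2 hE
    have hgood : k ≤ good.card := by
      have := Finset.card_filter_add_card_filter_not (s := Finset.range (2 * k))
        (fun i => e i ≤ G.energy f / k)
      rw [Finset.card_range] at this
      change good.card + bad.card = _ at this
      omega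
    have := G.lambda_le_of_disjoint h1 hk (ι := good) (by simpa using hgood)
      (F := fun i v => tent (t i) (t (i + 1)) (f v)) (C := C) (E := G.energy f / k) (by
        intro v i j hi hj
        obtain ⟨a1, a2⟩ := tent_ne_zero hi
        obtain ⟨b1, b2⟩ := tent_ne_zero hj
        refine Subtype.ext (le_antisymm ?_ ?_)
        · by_contra h
          have := hm (show (j : ℕ) + 1 ≤ i by omega)
          linarith
        · by_contra h
          have := hm (show (i : ℕ) + 1 ≤ j by omega)
          linarith) hC (by
        intro i
        have := hEq i (Finset.mem_range.mp (Finset.mem_filter.mp i.2).1)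
        simpa only [dotProduct, sq] using this) (fun i => (Finset.mem_filter.mp i.2).2)
    have h3 : 2 * (G.energy f / k) / C = G.lambda k / 2 := by
      rw [hCdef]; field_simp; norm_num
    linarith
  · refine ⟨(Finset.range (2 * k + 1)).image t, by simp, Finset.card_image_le.trans (by simp), ?_⟩
    calc ∑ v, Metric.infDist (f v) ((Finset.range (2 * k + 1)).image t : Finset ℝ) ^ 2
        ≤ ∑ v, ∑ i ∈ Finset.range (2 * k), tent (t i) (t (i + 1)) (f v) ^ 2 :=
          Finset.sum_le_sum fun v _ => infDist_sq_le_sum_tent_sq ht0 (hf v) (hmax v)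
      _ = ∑ i ∈ Finset.range (2 * k), ∑ v, tent (t i) (t (i + 1)) (f v) ^ 2 := Finset.sum_comm
      _ ≤ (2 * k : ℕ) • C := by
          refine (Finset.sum_le_card_nsmul _ _ C fun i _ => htC i).trans (by simp)
      _ = 8 * G.energy f / G.lambda k := by
          rw [hCdef, nsmul_eq_mul]; push_cast; field_simp; norm_num

/-- The improved Cheeger inequality. -/
theorem edgeExpansion_le_mul_div_sqrt (G : RegularWeightedGraph V) {k : ℕ} (h2 : 2 ≤ k)
    (hk : k ≤ Fintype.card V) :
    G.edgeExpansion ≤ 96 * k * G.lambda 2 / √(G.lambda k) := by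
  have hcheeger := G.edgeExpansion_le_sqrt (h2.trans hk)
  have hl2 := (G.lambda_mem_Icc 2).1
  have hlk := G.lambda_mem_Icc k
  -- If λ₂ = 0, Cheeger gives φ(G) ≤ 0 and the bound is 0 over something, which is 0 even when λ_k =
  -- 0.
  rcases eq_or_lt_of_le hl2 with h0 | hl2pos
  · rw [← h0] at hcheeger ⊢
    simpa using hcheeger
  have hlkpos : 0 < G.lambda k := hl2pos.trans_le (G.lambda_mono one_le_two h2 hk)
  obtain ⟨f, hf, hpos, hs, hEf⟩ := G.exists_nonneg_energy_le (h2.trans hk)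
  have hsq : 0 < √(G.lambda k) := Real.sqrt_pos.mpr hlkpos
  have hsq2 : √(G.lambda k) ≤ 2 := by
    rw [Real.sqrt_le_left (by norm_num)]
    linarith [hlk.2]
  have main : ∀ (T : Finset ℝ), T.Nonempty →
      G.edgeExpansion * (f ⬝ᵥ f) ≤ 8 * T.card * (G.energy f + √(2 * G.energy f) *
        √(∑ v, Metric.infDist (f v) T ^ 2) / 2) := by
    intro T hT
    have hTc : (0 : ℝ) < T.card := by exact_mod_cast hT.card_pos
    have c1 := G.edgeExpansion_mul_sum_le_variation (fun v => integralInfDist T (f v))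
      (fun v => integralInfDist_nonneg _ (hf v)) (by
        refine le_trans (Nat.mul_le_mul_left 2 (Finset.card_le_card fun v hv => ?_)) hs
        simp only [Finset.mem_filter, Finset.mem_univ, true_and] at hv ⊢
        intro h'
        rw [h', integralInfDist, intervalIntegral.integral_same] at hv
        exact hv rfl)
    have c2 := G.variation_le_of_abs_sub_le (f := f) (h := fun v => integralInfDist T (f v))
      (d := fun v => Metric.infDist (f v) T) zero_le_one
      (fun u v => by rw [one_mul]; exact abs_integralInfDist_sub_le T (f u) (f v))
    have c3 : f ⬝ᵥ f ≤ 8 * T.card * ∑ v, integralInfDist T (f v) := by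
      rw [Finset.mul_sum]
      refine Finset.sum_le_sum fun v _ => ?_
      have := sq_div_le_integralInfDist T hT (hf v)
      rw [div_le_iff₀ (by positivity)] at this
      nlinarith
    have c4 : (fun v => Metric.infDist (f v) (T : Set ℝ)) ⬝ᵥ
        (fun v => Metric.infDist (f v) (T : Set ℝ)) = ∑ v, Metric.infDist (f v) T ^ 2 := by
      simp only [dotProduct, sq]
    rw [c4, one_mul] at c2
    have c5 := mul_le_mul_of_nonneg_left c3 G.edgeExpansion_nonneg
    have c6 := mul_le_mul_of_nonneg_left (c1.trans c2) (by positivity : (0 : ℝ) ≤ 8 * T.card)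
    linarith
  -- The step approximation needs positive energy; for zero energy any T works, for example {0}.
  rcases eq_or_lt_of_le (G.energy_nonneg f) with hE0 | hEpos
  · have := main {0} (Finset.singleton_nonempty 0)
    rw [← hE0] at this
    simp only [mul_zero, Real.sqrt_zero, zero_mul, zero_div, add_zero] at this
    have : G.edgeExpansion ≤ 0 := by
      by_contra h
      nlinarith [mul_pos (not_le.mp h) hpos]
    exact this.trans (by positivity)
  · obtain ⟨T, hT, hTcard, hD⟩ := G.exists_step_approximation (by omega) hk hlkpos hf hEpos
    have hm := main T hT
    set E := G.energy f with hEdef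
    have hroot : √(2 * E) * √(∑ v, Metric.infDist (f v) T ^ 2) ≤ 4 * E / √(G.lambda k) := by
      rw [← Real.sqrt_mul (by positivity)]
      refine Real.sqrt_le_iff.mpr ⟨by positivity, ?_⟩
      rw [div_pow, Real.sq_sqrt hlkpos.le]
      calc 2 * E * ∑ v, Metric.infDist (f v) T ^ 2 ≤ 2 * E * (8 * E / G.lambda k) := by gcongr
        _ = (4 * E) ^ 2 / G.lambda k := by ring
    have hE2 : E ≤ 2 * E / √(G.lambda k) := by
      rw [le_div_iff₀ hsq]
      nlinarith
    have hT3 : (T.card : ℝ) ≤ 3 * k := by exact_mod_cast hTcard.trans (by omega)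
    have hfin : G.edgeExpansion * (f ⬝ᵥ f) ≤ 96 * k * G.lambda 2 / √(G.lambda k) * (f ⬝ᵥ f) := by
      calc G.edgeExpansion * (f ⬝ᵥ f) ≤ _ := hm
        _ ≤ 8 * (3 * k) * (4 * E / √(G.lambda k)) := by
          have : E + √(2 * E) * √(∑ v, Metric.infDist (f v) T ^ 2) / 2 ≤ 4 * E / √(G.lambda k) := by
            have e1 : 4 * E / √(G.lambda k) = 2 * (2 * E / √(G.lambda k)) := by ring
            linarith
          gcongr
        _ = 96 * k * E / √(G.lambda k) := by ring
        _ ≤ 96 * k * (G.lambda 2 * (f ⬝ᵥ f)) / √(G.lambda k) := by gcongr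
        _ = _ := by ring
    exact le_of_mul_le_mul_right hfin hpos


/-! ### Powers of the lazy random walk and their spectrum. -/

/-- The transition matrix of the lazy random walk. -/
noncomputable def lazyWalk (G : RegularWeightedGraph V) : Matrix V V ℝ :=
  (1 / 2 : ℝ) • (1 + G.weight)

theorem lazyWalk_pow_apply_nonneg (G : RegularWeightedGraph V) (t : ℕ) (u v : V) :
    0 ≤ (G.lazyWalk ^ t) u v := by
  induction t generalizing u v with
  | zero => rw [pow_zero, one_apply]; split_ifs <;> norm_num
  | succ t ih =>
    rw [pow_succ, mul_apply]
    refine Finset.sum_nonneg fun w _ => mul_nonneg (ih u w) ?_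
    have h1 : (0 : ℝ) ≤ (1 : Matrix V V ℝ) w v := by rw [one_apply]; split_ifs <;> norm_num
    have h2 := G.nonneg w v
    simp only [lazyWalk, Matrix.smul_apply, Matrix.add_apply, smul_eq_mul]
    linarith

theorem lazyWalk_pow_transpose (G : RegularWeightedGraph V) (t : ℕ) :
    (G.lazyWalk ^ t)ᵀ = G.lazyWalk ^ t := by
  have : G.weightᵀ = G.weight := by ext u v; exact G.symm v u
  rw [transpose_pow, lazyWalk, transpose_smul, transpose_add, transpose_one, this]

theorem sum_lazyWalk_pow_apply (G : RegularWeightedGraph V) (t : ℕ) (u : V) :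
    ∑ v, (G.lazyWalk ^ t) u v = 1 := by
  have h1 : G.lazyWalk *ᵥ (1 : V → ℝ) = 1 := by
    have h0 : G.weight *ᵥ (1 : V → ℝ) = 1 := by
      ext u
      simp [mulVec, dotProduct, G.total_weight]
    rw [lazyWalk, smul_mulVec, add_mulVec, one_mulVec, h0]
    ext u
    norm_num
  have h2 : G.lazyWalk ^ t *ᵥ (1 : V → ℝ) = 1 := by
    induction t with
    | zero => simp
    | succ t ih => rw [pow_succ, ← mulVec_mulVec, h1, ih]
  simpa [mulVec, dotProduct] using congrFun h2 u

/-- The graph of the `t`-th power of the lazy random walk. -/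
noncomputable def lazyPower (G : RegularWeightedGraph V) (t : ℕ) : RegularWeightedGraph V where
  weight := G.lazyWalk ^ t
  nonneg := G.lazyWalk_pow_apply_nonneg t
  symm u v := (congrFun (congrFun (G.lazyWalk_pow_transpose t) v) u)
  total_weight := G.sum_lazyWalk_pow_apply t

theorem dotProduct_lazyWalk_pow_mulVec (G : RegularWeightedGraph V) (t : ℕ) (f g : V → ℝ) :
    f ⬝ᵥ (G.lazyWalk ^ t *ᵥ g) = (G.lazyWalk ^ t *ᵥ f) ⬝ᵥ g := by
  rw [dotProduct_mulVec, ← mulVec_transpose, lazyWalk_pow_transpose]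

theorem lazyWalk_pow_mulVec (G : RegularWeightedGraph V) {b : V → ℝ} {e : ℝ}
    (hL : G.laplacian *ᵥ b = e • b) (t : ℕ) :
    G.lazyWalk ^ t *ᵥ b = (1 - e / 2) ^ t • b := by
  have h1 : G.lazyWalk *ᵥ b = (1 - e / 2) • b := by
    have hP : G.lazyWalk = 1 - (1 / 2 : ℝ) • G.laplacian := by
      ext u v
      simp only [lazyWalk, laplacian, Matrix.smul_apply, Matrix.add_apply, Matrix.sub_apply,
        smul_eq_mul]
      ring
    rw [hP, sub_mulVec, smul_mulVec, hL, one_mulVec]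
    ext v
    simp only [Pi.sub_apply, Pi.smul_apply, smul_eq_mul]
    ring
  induction t with
  | zero => simp
  | succ t ih => rw [pow_succ, ← mulVec_mulVec, h1, mulVec_smul, ih, smul_smul, pow_succ, mul_comm]

theorem dotProduct_lazyWalk_pow_eq_sum (G : RegularWeightedGraph V)
    {b : Fin (Fintype.card V) → V → ℝ}
    (hL : ∀ i, G.laplacian *ᵥ b i = G.laplacian_isHermitian.eigenvalues₀ i • b i)
    (hb : ∀ f : V → ℝ, f = ∑ i, (b i ⬝ᵥ f) • b i) (t : ℕ) (f : V → ℝ) :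
    f ⬝ᵥ (G.lazyWalk ^ t *ᵥ f) =
      ∑ i, (1 - G.laplacian_isHermitian.eigenvalues₀ i / 2) ^ t * (b i ⬝ᵥ f) ^ 2 := by
  rw [dotProduct_self_eq_sum hb]
  refine Finset.sum_congr rfl fun i _ => ?_
  rw [dotProduct_lazyWalk_pow_mulVec, G.lazyWalk_pow_mulVec (hL i), smul_dotProduct, smul_eq_mul]
  ring

/-- The moments of the lazy random walk at `f` are those of a measure on `[0, 1]`. -/
theorem exists_moments (G : RegularWeightedGraph V) (f : V → ℝ) :
    ∃ x m : Fin (Fintype.card V) → ℝ, (∀ i, x i ∈ Set.Icc (0 : ℝ) 1) ∧ (∀ i, 0 ≤ m i) ∧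
      ∀ t, f ⬝ᵥ (G.lazyWalk ^ t *ᵥ f) = ∑ i, x i ^ t * m i := by
  obtain ⟨b, -, hL, hb⟩ := G.exists_eigenbasis
  refine ⟨fun i => 1 - G.laplacian_isHermitian.eigenvalues₀ i / 2, fun i => (b i ⬝ᵥ f) ^ 2,
    fun i => ?_, fun i => sq_nonneg _, fun t => G.dotProduct_lazyWalk_pow_eq_sum hL hb t f⟩
  -- Laplacian eigenvalues lie in [0, 2], so laziness makes those of the walk nonnegative.
  have := G.eigenvalues₀_mem_Icc i
  constructor <;> linarith [this.1, this.2]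

theorem lazyPower_energy_eq_sum (G : RegularWeightedGraph V)
    {b : Fin (Fintype.card V) → V → ℝ}
    (hL : ∀ i, G.laplacian *ᵥ b i = G.laplacian_isHermitian.eigenvalues₀ i • b i)
    (hb : ∀ f : V → ℝ, f = ∑ i, (b i ⬝ᵥ f) • b i) (t : ℕ) (f : V → ℝ) :
    (G.lazyPower t).energy f =
      ∑ i, (1 - (1 - G.laplacian_isHermitian.eigenvalues₀ i / 2) ^ t) * (b i ⬝ᵥ f) ^ 2 := by
  rw [energy_eq_sub]
  change f ⬝ᵥ f - f ⬝ᵥ (G.lazyWalk ^ t *ᵥ f) = _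
  rw [G.dotProduct_lazyWalk_pow_eq_sum hL hb, dotProduct_self_eq_sum hb,
    ← Finset.sum_sub_distrib]
  exact Finset.sum_congr rfl fun i _ => by ring

/-- The eigenvalues of a power of the lazy random walk. -/
theorem lambda_lazyPower (G : RegularWeightedGraph V) (t : ℕ) {k : ℕ} (h1 : 1 ≤ k)
    (hk : k ≤ Fintype.card V) :
    (G.lazyPower t).lambda k = 1 - (1 - G.lambda k / 2) ^ t := by
  obtain ⟨b, ho, hL, hb⟩ := G.exists_eigenbasis
  let m : Fin (Fintype.card V) := ⟨Fintype.card V - k, by omega⟩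
  have hlk : G.lambda k = G.laplacian_isHermitian.eigenvalues₀ m := G.lambda_eq h1 hk
  have hzero : ∀ (I : Finset (Fin (Fintype.card V))) (c : I → ℝ) (i), i ∉ I →
      b i ⬝ᵥ (∑ j, c j • b j.1) = 0 := by
    intro I c i hi
    rw [dotProduct_sum]
    refine Finset.sum_eq_zero fun j _ => ?_
    rw [dotProduct_smul, ho, if_neg, smul_zero]
    rintro rfl
    exact hi j.2
  have hli := linearIndependent_of_orthonormal ho
  -- The map e ↦ (1 − e/2)^t is decreasing on [0, 2], so the power keeps both the eigenvectors and
  -- their order; the two min-max bounds then pin down λ_k.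
  have hmono : ∀ i j, i ≤ j →
      (1 - G.laplacian_isHermitian.eigenvalues₀ i / 2) ^ t ≤
        (1 - G.laplacian_isHermitian.eigenvalues₀ j / 2) ^ t := by
    intro i j hij
    have h2 := G.laplacian_isHermitian.eigenvalues₀_antitone hij
    have h3 := (G.eigenvalues₀_mem_Icc i).2
    exact pow_le_pow_left₀ (by linarith) (by linarith) t
  apply le_antisymm
  · refine (G.lazyPower t).lambda_le_of_linearIndependent h1 hk (ι := Finset.Ici m) ?_
      (hli.comp _ Subtype.val_injective) fun c => ?_
    · rw [Fintype.card_coe, Fin.card_Ici]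
      simp only [m]
      omega
    · simp only [Function.comp_apply]
      rw [G.lazyPower_energy_eq_sum hL hb, dotProduct_self_eq_sum hb, Finset.mul_sum, hlk]
      refine Finset.sum_le_sum fun i _ => ?_
      by_cases hi : i ∈ Finset.Ici m
      · have := hmono _ _ (Finset.mem_Ici.mp hi)
        nlinarith [sq_nonneg (b i ⬝ᵥ (∑ j : Finset.Ici m, c j • b j.1))]
      · rw [hzero _ c i hi]; simp
  · refine (G.lazyPower t).le_lambda_of_linearIndependent h1 hk (ι := Finset.Iic m) ?_
      (hli.comp _ Subtype.val_injective) fun c => ?_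
    · rw [Fintype.card_coe, Fin.card_Iic]
      simp only [m]
      omega
    · simp only [Function.comp_apply]
      rw [G.lazyPower_energy_eq_sum hL hb, dotProduct_self_eq_sum hb, Finset.mul_sum, hlk]
      refine Finset.sum_le_sum fun i _ => ?_
      by_cases hi : i ∈ Finset.Iic m
      · have := hmono _ _ (Finset.mem_Iic.mp hi)
        nlinarith [sq_nonneg (b i ⬝ᵥ (∑ j : Finset.Iic m, c j • b j.1))]
      · rw [hzero _ c i hi]; simp

/-! ### Cubic rounding and the reduction to λ_k ≥ 1/4. -/

theorem mul_pow_mul_one_sub_le {x : ℝ} (h0 : 0 ≤ x) (h1 : x ≤ 1) (n : ℕ) :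
    (n + 1) * (x ^ n * (1 - x)) ≤ 1 - x ^ (n + 1) := by
  have h := geom_sum_mul x (n + 1)
  have h2 : ((n + 1 : ℕ) : ℝ) * x ^ n ≤ ∑ i ∈ Finset.range (n + 1), x ^ i := by
    have := Finset.card_nsmul_le_sum (Finset.range (n + 1)) (fun i => x ^ i) (x ^ n)
      fun i hi => pow_le_pow_of_le_one h0 h1 (by rw [Finset.mem_range] at hi; omega)
    simpa using this
  push_cast at h2
  nlinarith [mul_le_mul_of_nonneg_right h2 (sub_nonneg.mpr h1)]

/-- The derivative 6a(1 − a) is at most six times the distance from a to either endpoint. This is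
the shape needed by `variation_le_of_abs_sub_le`. -/
theorem abs_smoothstep_sub_le {a b c : ℝ} (ha : a ∈ Set.Icc (0 : ℝ) 1) (hb : b ∈ Set.Icc (0 : ℝ) 1)
    (hc : c = 0 ∨ c = 1) :
    |(3 * a ^ 2 - 2 * a ^ 3) - (3 * b ^ 2 - 2 * b ^ 3)| ≤
      6 * (|a - b| * (|a - b| + |c - a|)) := by
  obtain ⟨ha0, ha1⟩ := ha
  obtain ⟨hb0, hb1⟩ := hb
  have hfac : (3 * a ^ 2 - 2 * a ^ 3) - (3 * b ^ 2 - 2 * b ^ 3) =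
      (a - b) * (3 * (a + b) - 2 * (a ^ 2 + a * b + b ^ 2)) := by ring
  have hq0 : 0 ≤ 3 * (a + b) - 2 * (a ^ 2 + a * b + b ^ 2) := by
    nlinarith [mul_nonneg ha0 (sub_nonneg.mpr ha1), mul_nonneg hb0 (sub_nonneg.mpr hb1),
      mul_nonneg ha0 (sub_nonneg.mpr hb1), mul_nonneg hb0 (sub_nonneg.mpr ha1)]
  rw [hfac, abs_mul, abs_of_nonneg hq0, mul_left_comm]
  refine mul_le_mul_of_nonneg_left ?_ (abs_nonneg _)
  have hab := le_abs_self (a - b)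
  have hab' := neg_abs_le (a - b)
  rcases hc with rfl | rfl
  · rw [zero_sub, abs_neg, abs_of_nonneg ha0]
    nlinarith [mul_nonneg ha0 hb0, sq_nonneg a, sq_nonneg b]
  · rw [abs_of_nonneg (by linarith : 0 ≤ 1 - a)]
    nlinarith [mul_nonneg (sub_nonneg.mpr ha1) (sub_nonneg.mpr hb1), sq_nonneg (1 - a),
      sq_nonneg (1 - b)]

/-- Second-order flatness at 0 and 1 turns a squared ℓ² error into an ℓ¹ error. -/
theorem abs_smoothstep_sub_le_sq {a c : ℝ} (ha : a ∈ Set.Icc (0 : ℝ) 1) (hc : c = 0 ∨ c = 1) :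
    |(3 * a ^ 2 - 2 * a ^ 3) - c| ≤ 3 * (c - a) ^ 2 := by
  obtain ⟨ha0, ha1⟩ := ha
  have h3 : 0 ≤ a ^ 3 := pow_nonneg ha0 3
  have h4 : 0 ≤ (1 - a) ^ 3 := pow_nonneg (sub_nonneg.mpr ha1) 3
  rcases hc with rfl | rfl <;> rw [abs_le] <;> constructor <;>
    nlinarith [mul_nonneg (sq_nonneg a) (sub_nonneg.mpr ha1),
      mul_nonneg (sq_nonneg (1 - a)) ha0]

/-- Powers of the lazy random walk expand: `φ(S)` in the `t`-th power is at least of order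
`√t φ(G)`, as long as it is small. -/
theorem edgeExpansion_mul_le_lazyPower (G : RegularWeightedGraph V) [Nonempty V] (s : ℕ)
    (S : Finset V) (hS : 2 * S.card ≤ Fintype.card V) :
    G.edgeExpansion * (S.card - 3 * (G.lazyPower (2 * s + 1)).weightBetween S Sᶜ) ≤
      6 * ((G.lazyPower (2 * s + 1)).weightBetween S Sᶜ *
        (2 / (2 * s + 1) + 1 / √(2 * s + 1))) := by
  set t : ℝ := 2 * s + 1 with ht
  have htpos : 0 < t := by positivity
  set D := (G.lazyPower (2 * s + 1)).weightBetween S Sᶜ with hD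
  let χ : V → ℝ := fun v => if v ∈ S then 1 else 0
  have hχ : ∀ v, χ v = 0 ∨ χ v = 1 := fun v => by
    by_cases hv : v ∈ S <;> simp [χ, hv]
  let g : V → ℝ := G.lazyWalk ^ s *ᵥ χ
  have hg : ∀ v, g v ∈ Set.Icc (0 : ℝ) 1 := by
    intro u
    constructor
    · refine Finset.sum_nonneg fun v _ => mul_nonneg (G.lazyWalk_pow_apply_nonneg s u v) ?_
      rcases hχ v with h | h <;> rw [h]
      exact zero_le_one
    · rw [← G.sum_lazyWalk_pow_apply s u]
      refine Finset.sum_le_sum fun v _ => mul_le_of_le_one_right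
        (G.lazyWalk_pow_apply_nonneg s u v) ?_
      rcases hχ v with h | h <;> rw [h]
      exact zero_le_one
  have hDE : D = (G.lazyPower (2 * s + 1)).energy χ := by
    have := (G.lazyPower (2 * s + 1)).two_mul_weightBetween_compl S
    have h2 : ∑ u, ∑ v, (G.lazyPower (2 * s + 1)).weight u v *
        (if (u ∈ S ↔ v ∈ S) then 0 else 1) =
        ∑ u, ∑ v, (G.lazyPower (2 * s + 1)).weight u v * (χ u - χ v) ^ 2 := by
      refine Finset.sum_congr rfl fun u _ => Finset.sum_congr rfl fun v _ => ?_
      by_cases hu : u ∈ S <;> by_cases hv : v ∈ S <;> simp [χ, hu, hv]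
    rw [energy, ← h2, ← this]
    ring
  obtain ⟨x, m, hx, hm, hmom⟩ := G.exists_moments χ
  have hself : χ ⬝ᵥ χ = ∑ i, m i := by
    have := hmom 0
    simpa using this
  have hDm : D = ∑ i, (1 - x i ^ (2 * s + 1)) * m i := by
    rw [hDE, energy_eq_sub]
    change χ ⬝ᵥ χ - χ ⬝ᵥ (G.lazyWalk ^ (2 * s + 1) *ᵥ χ) = _
    rw [hmom, hself, ← Finset.sum_sub_distrib]
    exact Finset.sum_congr rfl fun i _ => by ring
  have hgg : g ⬝ᵥ g = ∑ i, x i ^ (2 * s) * m i := by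
    rw [← hmom, two_mul, pow_add, ← mulVec_mulVec, G.dotProduct_lazyWalk_pow_mulVec s χ]
  have hgPg : g ⬝ᵥ (G.lazyWalk *ᵥ g) = ∑ i, x i ^ (2 * s + 1) * m i := by
    rw [← hmom, show 2 * s + 1 = s + (1 + s) by ring, pow_add, pow_add, pow_one,
      ← mulVec_mulVec, ← mulVec_mulVec, dotProduct_lazyWalk_pow_mulVec]
  have hEg : G.energy g = 2 * (g ⬝ᵥ g - g ⬝ᵥ (G.lazyWalk *ᵥ g)) := by
    rw [energy_eq_sub, lazyWalk, smul_mulVec, add_mulVec, one_mulVec, dotProduct_smul,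
      dotProduct_add, smul_eq_mul]
    ring
  -- Spectrally, 2∑x^(2s)(1 − x)m against ∑(1 − x^t)m. The odd exponent t = 2s + 1 arises because
  -- ⟨g, Pg⟩ is the moment of order 2s + 1.
  have hE : G.energy g ≤ 2 * D / t := by
    rw [hEg, hgg, hgPg, hDm, le_div_iff₀ htpos, mul_assoc, mul_comm _ t,
      ← Finset.sum_sub_distrib, Finset.mul_sum]
    refine mul_le_mul_of_nonneg_left (Finset.sum_le_sum fun i _ => ?_) zero_le_two
    have := mul_pow_mul_one_sub_le (hx i).1 (hx i).2 (2 * s)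
    push_cast at this
    rw [← ht] at this
    calc t * (x i ^ (2 * s) * m i - x i ^ (2 * s + 1) * m i)
        = t * (x i ^ (2 * s) * (1 - x i)) * m i := by ring
      _ ≤ _ := mul_le_mul_of_nonneg_right this (hm i)
  -- Spectrally, (1 − x^s)² ≤ 1 − x^s ≤ 1 − x^(2s+1) on [0, 1].
  have hdist : ∑ v, (χ v - g v) ^ 2 ≤ D := by
    have h1 : ∑ v, (χ v - g v) ^ 2 = χ ⬝ᵥ χ - 2 * (χ ⬝ᵥ g) + g ⬝ᵥ g := by
      simp only [dotProduct, Finset.mul_sum, ← Finset.sum_add_distrib, ← Finset.sum_sub_distrib]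
      exact Finset.sum_congr rfl fun v _ => by ring
    have h2 : χ ⬝ᵥ g = ∑ i, x i ^ s * m i := hmom s
    rw [h1, hself, h2, hgg, hDm, Finset.mul_sum, ← Finset.sum_sub_distrib,
      ← Finset.sum_add_distrib]
    refine Finset.sum_le_sum fun i _ => ?_
    have hp0 : 0 ≤ x i ^ s := pow_nonneg (hx i).1 s
    have hp1 : x i ^ s ≤ 1 := pow_le_one₀ (hx i).1 (hx i).2
    have hp2 : x i ^ (2 * s + 1) ≤ x i ^ s :=
      pow_le_pow_of_le_one (hx i).1 (hx i).2 (by omega)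
    have : 1 - 2 * x i ^ s + x i ^ (2 * s) ≤ 1 - x i ^ (2 * s + 1) := by
      rw [two_mul s, pow_add]
      rw [two_mul s] at hp2
      nlinarith
    calc m i - 2 * (x i ^ s * m i) + x i ^ (2 * s) * m i
        = (1 - 2 * x i ^ s + x i ^ (2 * s)) * m i := by ring
      _ ≤ _ := mul_le_mul_of_nonneg_right this (hm i)
  have hD0 : 0 ≤ D := (Finset.sum_nonneg fun v _ => sq_nonneg _).trans hdist
  let h : V → ℝ := fun v => 3 * g v ^ 2 - 2 * g v ^ 3
  have hvar := G.variation_le_of_abs_sub_le (f := g) (h := h) (d := fun v => |χ v - g v|)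
    (K := 6) (by norm_num) fun u v => abs_smoothstep_sub_le (hg u) (hg v) (hχ u)
  have hvar' : G.variation h ≤ 6 * (D * (2 / t + 1 / √t)) := by
    refine hvar.trans (mul_le_mul_of_nonneg_left ?_ (by norm_num))
    have hdd : (fun v => |χ v - g v|) ⬝ᵥ (fun v => |χ v - g v|) = ∑ v, (χ v - g v) ^ 2 := by
      simp only [dotProduct, abs_mul_abs_self, sq]
    have hst : 0 < √t := Real.sqrt_pos.mpr htpos
    have hroot : √(2 * G.energy g) * √(∑ v, (χ v - g v) ^ 2) ≤ 2 * D / √t := by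
      have hE0 := G.energy_nonneg g
      rw [← Real.sqrt_mul (by linarith)]
      refine Real.sqrt_le_iff.mpr ⟨by positivity, ?_⟩
      rw [div_pow, Real.sq_sqrt htpos.le]
      calc 2 * G.energy g * ∑ v, (χ v - g v) ^ 2 ≤ 2 * (2 * D / t) * D := by gcongr
        _ = (2 * D) ^ 2 / t := by ring
    rw [hdd]
    calc G.energy g + √(2 * G.energy g) * √(∑ v, (χ v - g v) ^ 2) / 2
        ≤ 2 * D / t + 2 * D / √t / 2 := by gcongr
      _ = D * (2 / t + 1 / √t) := by ring
  obtain ⟨c, hc⟩ := G.exists_edgeExpansion_mul_sum_abs_le h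
  have hsum : (S.card : ℝ) - 3 * D ≤ ∑ v, |h v - c| := by
    -- Since |S| ≤ |Sᶜ|, no constant c is closer than |S| to the indicator in ℓ¹.
    have h1 : (S.card : ℝ) ≤ ∑ v, |χ v - c| := by
      rw [← Finset.sum_add_sum_compl S]
      have e1 : ∑ v ∈ S, |χ v - c| = S.card * |1 - c| := by
        rw [Finset.sum_congr rfl (g := fun _ => |1 - c|) fun v hv => by simp [χ, hv]]
        simp
      have e2 : ∑ v ∈ Sᶜ, |χ v - c| = (Sᶜ.card : ℝ) * |c| := by
        rw [Finset.sum_congr rfl (g := fun _ => |c|) fun v hv => by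
          simp [χ, Finset.mem_compl.mp hv]]
        simp
      rw [e1, e2]
      have hcc : (S.card : ℝ) ≤ Sᶜ.card := by
        rw [Finset.card_compl]
        exact_mod_cast (by omega : S.card ≤ Fintype.card V - S.card)
      have h3 : 1 ≤ |1 - c| + |c| := by
        have := abs_add_le (1 - c) c
        simpa using this
      have h4 : (0 : ℝ) ≤ S.card := Nat.cast_nonneg _
      nlinarith [abs_nonneg c, mul_le_mul_of_nonneg_right hcc (abs_nonneg c)]
    have h2 : ∑ v, |χ v - c| ≤ ∑ v, |h v - c| + 3 * ∑ v, (χ v - g v) ^ 2 := by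
      rw [Finset.mul_sum, ← Finset.sum_add_distrib]
      refine Finset.sum_le_sum fun v _ => ?_
      have h3 := abs_smoothstep_sub_le_sq (hg v) (hχ v)
      have h4 := abs_sub_le (χ v) (h v) c
      rw [abs_sub_comm (χ v) (h v)] at h4
      linarith
    linarith
  exact (mul_le_mul_of_nonneg_left hsum G.edgeExpansion_nonneg).trans (hc.trans hvar')

theorem one_sub_pow_le_inv {x : ℝ} (h0 : 0 ≤ x) (h1 : x ≤ 1) (t : ℕ) :
    (1 - x) ^ t * (1 + t * x) ≤ 1 := by
  have h2 : 1 + t * x ≤ (1 + x) ^ t := one_add_mul_le_pow (by linarith) t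
  calc (1 - x) ^ t * (1 + t * x) ≤ (1 - x) ^ t * (1 + x) ^ t :=
        mul_le_mul_of_nonneg_left h2 (pow_nonneg (by linarith) t)
    _ = (1 - x ^ 2) ^ t := by rw [← mul_pow]; ring
    _ ≤ 1 := pow_le_one₀ (by nlinarith) (by nlinarith [sq_nonneg x])

/-- The reduction of the improved Cheeger inequality to graphs with `λ_k ≥ 1/4`. -/
theorem edgeExpansion_le_of_forall (k : ℕ) (C : ℝ) (h2 : 2 ≤ k) (hC : 1 / 10 ≤ C)
    (G : RegularWeightedGraph V) (hk : k ≤ Fintype.card V)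
    (H : ∀ H : RegularWeightedGraph V, 1 / 4 ≤ H.lambda k → H.edgeExpansion ≤ C * H.lambda 2) :
    G.edgeExpansion ≤ 40 * C * G.lambda 2 / √(G.lambda k) := by
  have hV := h2.trans hk
  have : Nonempty V := Fintype.card_pos_iff.mp (by omega)
  have hcheeger := G.edgeExpansion_le_sqrt hV
  have hl2 := G.lambda_mem_Icc 2
  have hlk := G.lambda_mem_Icc k
  rcases eq_or_lt_of_le hl2.1 with h0 | hl2pos
  · rw [← h0] at hcheeger ⊢
    simpa using hcheeger
  have hlkpos : 0 < G.lambda k := hl2pos.trans_le (G.lambda_mono one_le_two h2 hk)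
  have hsq : 0 < √(G.lambda k) := Real.sqrt_pos.mpr hlkpos
  have hCpos : 0 < C := by linarith
  set l := G.lambda k with hl
  -- This puts tλ_k between 2/3 and 20/3: the lower bound yields (1 − λ_k/2)^t ≤ 3/4, the upper one
  -- limits the final constant.
  set s := ⌈1 / (3 * l)⌉₊ with hs
  have hs1 : 1 / (3 * l) ≤ s := Nat.le_ceil _
  have hs2 : (s : ℝ) < 1 / (3 * l) + 1 := Nat.ceil_lt_add_one (by positivity)
  have hsl1 : 1 / 3 ≤ s * l := by
    rw [div_le_iff₀ (by positivity)] at hs1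
    linarith
  have hsl2 : s * l ≤ 1 / 3 + l := by
    have := mul_le_mul_of_nonneg_right hs2.le hlkpos.le
    have e : (1 / (3 * l) + 1) * l = 1 / 3 + l := by field_simp
    linarith
  set t : ℝ := 2 * s + 1 with ht
  have htpos : 0 < t := by positivity
  have htl1 : 2 / 3 ≤ t * l := by rw [ht]; nlinarith
  have htl2 : t * l ≤ 20 / 3 := by rw [ht]; nlinarith [hlk.2]
  have hcast : ((2 * s + 1 : ℕ) : ℝ) = t := by push_cast; rfl
  have hHk : 1 / 4 ≤ (G.lazyPower (2 * s + 1)).lambda k := by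
    rw [G.lambda_lazyPower _ (by omega) hk, ← hl]
    have := one_sub_pow_le_inv (x := l / 2) (by linarith) (by linarith [hlk.2]) (2 * s + 1)
    rw [hcast] at this
    have hp : 0 ≤ (1 - l / 2) ^ (2 * s + 1) := pow_nonneg (by linarith [hlk.2]) _
    nlinarith
  have hH2 : (G.lazyPower (2 * s + 1)).lambda 2 ≤ t * (G.lambda 2 / 2) := by
    rw [G.lambda_lazyPower _ one_le_two hV]
    have := one_add_mul_le_pow (a := -(G.lambda 2 / 2)) (by linarith [hl2.2]) (2 * s + 1)
    rw [hcast, ← sub_eq_add_neg] at this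
    linarith
  have hHφ := (H _ hHk).trans (mul_le_mul_of_nonneg_left hH2 hCpos.le)
  obtain ⟨S, hSne, hS, hSφ⟩ := ((G.lazyPower (2 * s + 1)).isLeast_edgeExpansion hV).1
  have hN : (0 : ℝ) < S.card := by exact_mod_cast hSne.card_pos
  set δ := (G.lazyPower (2 * s + 1)).edgeExpansion with hδ
  have hD : (G.lazyPower (2 * s + 1)).weightBetween S Sᶜ = δ * S.card := by
    rw [hSφ, setExpansion, div_mul_cancel₀ _ hN.ne']
  have hδ0 : 0 ≤ δ := edgeExpansion_nonneg _
  have key := G.edgeExpansion_mul_le_lazyPower s S hS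
  rw [hD, ← ht] at key
  have hst : 0 < √t := Real.sqrt_pos.mpr htpos
  have hstt : √t * √t = t := Real.mul_self_sqrt htpos.le
  have hφ0 := G.edgeExpansion_nonneg
  -- For δ ≤ 1/6 the loss 3δ is at most a half. Otherwise Cλ₂t ≥ 1/3, which with C ≥ 1/10 gives λ_k
  -- ≤ 200C²λ₂, and Cheeger's √(2λ₂) is small enough.
  by_cases hsat : δ ≤ 1 / 6
  · have h3 : G.edgeExpansion * (1 - 3 * δ) ≤ 6 * (δ * (2 / t + 1 / √t)) := by
      refine le_of_mul_le_mul_right ?_ hN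
      linarith
    have h4 : G.edgeExpansion ≤ 12 * (δ * (2 / t + 1 / √t)) := by nlinarith
    have h5 : 12 * (δ * (2 / t + 1 / √t)) ≤ 6 * (C * G.lambda 2 * (2 + √t)) := by
      calc 12 * (δ * (2 / t + 1 / √t))
          ≤ 12 * ((C * (t * (G.lambda 2 / 2))) * (2 / t + 1 / √t)) := by gcongr
        _ = 6 * (C * G.lambda 2 * (2 + t / √t)) := by field_simp; ring
        _ = _ := by rw [Real.div_sqrt]
    refine (h4.trans h5).trans ?_
    rw [le_div_iff₀ hsq]
    have h6 : √t * √l ≤ 2.6 := by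
      rw [← Real.sqrt_mul htpos.le]
      exact Real.sqrt_le_iff.mpr ⟨by norm_num, by linarith⟩
    have h7 : √l ≤ 1.5 := Real.sqrt_le_iff.mpr ⟨by norm_num, by linarith [hlk.2]⟩
    have h8 : 0 ≤ C * G.lambda 2 := by positivity
    nlinarith [mul_le_mul_of_nonneg_left h6 h8, mul_le_mul_of_nonneg_left h7 h8]
  · refine hcheeger.trans ?_
    have h3 : 1 / 6 ≤ C * (t * (G.lambda 2 / 2)) := (not_le.mp hsat).le.trans hHφ
    rw [le_div_iff₀ hsq, ← Real.sqrt_mul (by linarith)]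
    refine Real.sqrt_le_iff.mpr ⟨by positivity, ?_⟩
    have h4 : 1 / 30 ≤ C ^ 2 * (t * G.lambda 2) := by
      have h' : 1 / 3 ≤ C * (t * G.lambda 2) := by linarith
      calc (1 / 30 : ℝ) = 1 / 10 * (1 / 3) := by norm_num
        _ ≤ C * (C * (t * G.lambda 2)) := by gcongr
        _ = _ := by ring
    have h5 : l * (1 / 30) ≤ 20 / 3 * (C ^ 2 * G.lambda 2) := by
      calc l * (1 / 30) ≤ l * (C ^ 2 * (t * G.lambda 2)) := by gcongr
        _ = (t * l) * (C ^ 2 * G.lambda 2) := by ring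
        _ ≤ _ := by gcongr
    have h6 : l ≤ 200 * (C ^ 2 * G.lambda 2) := by linarith
    calc 2 * G.lambda 2 * l ≤ 2 * G.lambda 2 * (200 * (C ^ 2 * G.lambda 2)) := by gcongr
      _ = 400 * (C * G.lambda 2) ^ 2 := by ring
      _ ≤ 1600 * (C * G.lambda 2) ^ 2 := by gcongr; norm_num
      _ = (40 * C * G.lambda 2) ^ 2 := by ring

end RegularWeightedGraph

theorem mainTheorem7 :
    (∀ (k : ℕ) (C : ℝ), 2 ≤ k → 1 / 10 ≤ C →
      (∀ (V : Type u) [Fintype V] [DecidableEq V] (H : RegularWeightedGraph V),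
        k ≤ Fintype.card V → 1 / 4 ≤ H.lambda k → H.edgeExpansion ≤ C * H.lambda 2) →
      ∀ (V : Type u) [Fintype V] [DecidableEq V] (G : RegularWeightedGraph V),
        k ≤ Fintype.card V →
          G.edgeExpansion ≤ 40 * C * G.lambda 2 / Real.sqrt (G.lambda k)) ∧
    (∃ K : ℝ, 0 < K ∧
      ∀ (k : ℕ), 2 ≤ k →
        ∀ (V : Type u) [Fintype V] [DecidableEq V] (G : RegularWeightedGraph V),
          k ≤ Fintype.card V →
            G.edgeExpansion ≤ K * (k : ℝ) * G.lambda 2 / Real.sqrt (G.lambda k)) := by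
  refine ⟨fun k C h2 hC H V _ _ G hk => ?_, 96, by norm_num, fun k h2 V _ _ G hk => ?_⟩
  -- The hypothesis is needed only for graphs on the vertex set of G, since the walk power lives
  -- there.
  · exact RegularWeightedGraph.edgeExpansion_le_of_forall k C h2 hC G hk fun H' => H V H' hk
  · exact G.edgeExpansion_le_mul_div_sqrt h2 hk
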